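/- Let $P$ be a regular pentagon in the plane with a horizontal diagonal, and let the double pentagon be the translation surface obtained from $P$ and $-P$ by gluing each side of $P$ to the parallel side of $-P$ by a translation. Directions of linear trajectories are taken up to sign. Let $\phi=\frac{1+\sqrt5}{2}$. Put on the line $\mathbb{RP}^1=\mathbb R\cup\{\infty\}$ of directions the affine coordinate for which $x\in\mathbb R$ is the direction of the vector $(x,\sin 36^\circ)$ and $\infty$ is the horizontal direction; the five directions of the diagonals then have the coordinates $1-\frac\phi2,\ \frac\phi2,\ \infty,\ -\frac\phi2,\ \frac\phi2-1$. View $\mathbb{RP}^1$ as the circle at infinity of the hyperbolic plane, and let the ideal pentagon of generation $0$ be the one with these five vertices (in this cyclic order). Let $\Gamma$ be the group generated by $$T(x)=\frac{2\phi x+3-\phi}{2\phi-4x},\qquad R(x)=\frac1{4\phi^4x}.$$ The ideal pentagons of all generations are the images of the one of generation $0$ under $\Gamma$. For a direction $x$, consider the trajectories in the direction $x$ that avoid the vertices of the pentagons. The symbolic orbit of such a trajectory is the bi-infinite word of labels of the consecutively crossed sides (the five sides of $P$ have different labels, and glued sides have equal labels); in the interval exchange model it is the word of labels of the four intervals visited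 by the first return map to the horizontal diagonal of $P$, where an interval consists of the points from which the trajectory crosses the same two sides before it returns. Words are considered up to a shift. Say that $x$ has the pair of periods $(a,A)$ if in the direction $x$ there are exactly two symbolic orbits (one for each of two strips of parallel periodic trajectories), both periodic, with least periods $a\le A$. Let $\beta$ be a vertex of an ideal pentagon of some generation with $\frac\phi2-1<\beta<1-\frac\phi2$. Then the points joined to $\beta$ by sides of ideal pentagons can be listed as $\dots,\gamma_{-2},\gamma_{-1},\gamma_0,\gamma_1,\gamma_2,\dots$ so that they are all real, $\gamma_0,\gamma_1,\gamma_2,\dots$ are the ones on one side of $\beta$ and $\gamma_{-1},\gamma_{-2},\gamma_{-3},\dots$ are the ones on the other side of $\beta$, both without repetition and in the order in which they approach $\beta$. Moreover, for every such list and for either of the two kinds of symbolic orbits, $\beta$ has a pair of periods $(b,B)$, every $\gamma_i$ has a pair of periods, and if $(c_i,C_i)$ denotes the pair of periods of $\gamma_i$, multiplied by $-1$ if $i<0$, then $$\dots,(c_{-2},C_{-2}),(c_{-1},C_{-1}),(c_0,C_0),(c_1,C_1),(c_2,C_2),\dots$$ is an arithmetic sequence with the difference $(B,b+B)$, that is,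 $c_{i+1}-c_i=B$ and $C_{i+1}-C_i=b+B$ for all $i\in\mathbb Z$. -/

import Mathlib

noncomputable section

namespace DoublePentagon

open Matrix

/-! ### Directions and the tiling by ideal pentagons

The real projective line of directions is `OnePoint ℝ`, with its Möbius action of `GL (Fin 2) ℝ`. -/

/-- The vertices of the ideal pentagon of generation `0`, in cyclic order. -/
def baseVertex : Fin 5 → OnePoint ℝ :=
  ![((1 - Real.goldenRatio / 2 : ℝ) : OnePoint ℝ), ((Real.goldenRatio / 2 : ℝ) : OnePoint ℝ),
    OnePoint.infty, ((-(Real.goldenRatio / 2) : ℝ) : OnePoint ℝ),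
    ((Real.goldenRatio / 2 - 1 : ℝ) : OnePoint ℝ)]

/-- The rotation `T x = (2 φ x + 3 - φ) / (2 φ - 4 x)`. -/
def rotT : GL (Fin 2) ℝ :=
  GeneralLinearGroup.mkOfDetNeZero
    !![2 * Real.goldenRatio, 3 - Real.goldenRatio; -4, 2 * Real.goldenRatio] (by
      have h := Real.goldenRatio_sq
      rw [Matrix.det_fin_two_of]
      nlinarith)

/-- The reflection `R x = 1 / (4 φ ^ 4 x)` in the side of the ideal pentagon of generation `0`
that joins `1 - φ / 2` and `φ / 2 - 1`. -/
def reflR : GL (Fin 2) ℝ :=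
  GeneralLinearGroup.mkOfDetNeZero !![0, 1; 4 * Real.goldenRatio ^ 4, 0] (by
    rw [Matrix.det_fin_two_of]
    have h := pow_pos Real.goldenRatio_pos 4
    nlinarith)

/-- The group generated by `T` and `R`. The ideal pentagons of all generations are the images of
the ideal pentagon of generation `0` under this group. -/
def tilingGroup : Subgroup (GL (Fin 2) ℝ) := Subgroup.closure {rotT, reflR}

/-- `x` is a vertex of an ideal pentagon of some generation. -/
def IsTilingVertex (x : OnePoint ℝ) : Prop :=
  ∃ g ∈ tilingGroup, ∃ j : Fin 5, x = g • baseVertex j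

/-- `x` and `y` are the two ends of a side of an ideal pentagon of some generation. -/
def JoinedBySide (x y : OnePoint ℝ) : Prop :=
  ∃ g ∈ tilingGroup, ∃ j : Fin 5,
    (x = g • baseVertex j ∧ y = g • baseVertex (j + 1)) ∨
    (y = g • baseVertex j ∧ x = g • baseVertex (j + 1))

/-- `γ` lists all the points joined to `β` by sides of ideal pentagons: those on one side of `β`
are `γ 0, γ 1, γ 2, …`, and those on the other side are `γ (-1), γ (-2), γ (-3), …`, both in the
order in which they approach `β`. (Either side of `β` may come first.) -/
structure IsFan (β : ℝ) (γ : ℤ → ℝ) : Prop where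
  joined_iff : ∀ y : OnePoint ℝ, JoinedBySide (β : OnePoint ℝ) y ↔ ∃ i : ℤ, y = (γ i : OnePoint ℝ)
  ordered :
    ((∀ i, 0 ≤ i → β < γ i) ∧ (∀ i, i < 0 → γ i < β) ∧
      StrictAntiOn γ (Set.Ici 0) ∧ StrictAntiOn γ (Set.Iio 0)) ∨
    ((∀ i, 0 ≤ i → γ i < β) ∧ (∀ i, i < 0 → β < γ i) ∧
      StrictMonoOn γ (Set.Ici 0) ∧ StrictMonoOn γ (Set.Iio 0))

/-! ### Trajectories on the double pentagon -/

/-- The vertices of a regular pentagon `P` in the plane, symmetric about the vertical axis.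
Its side number `j` goes from `vertex j` to `vertex (j + 1)`. -/
def vertex (j : Fin 5) : ℂ :=
  Complex.I * Complex.exp (2 * Real.pi * Complex.I * (j : ℕ) / 5)

/-- The translation by `-sideShift j` takes the side `j` of `P` to the parallel side of the
centrally symmetric pentagon `Q = -P`. The double pentagon is `P` and `Q`, glued along these five
translations. -/
def sideShift (j : Fin 5) : ℂ := vertex j + vertex (j + 1)

/-- The direction with affine coordinate `x`. The direction `∞` is that of the horizontal diagonal
of `P`, and the five directions of diagonals have the coordinates
`1 - φ / 2, φ / 2, ∞, -φ / 2, φ / 2 - 1`. -/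
def direction (x : ℝ) : ℂ := (x : ℂ) + (Real.sin (Real.pi / 5) : ℂ) * Complex.I

/-- A linear trajectory on the double pentagon in the direction of the vector `d` that never meets
a vertex, followed for all times and recorded at its successive crossings of the sides. The `n`-th
crossing goes through the side `s n`, from `P` to `Q` if `n` is even and from `Q` to `P` if `n` is
odd, at the point `p n` of that side of `P` (which is glued to the point `p n - sideShift (s n)`
of `Q`). Between two crossings the trajectory is a straight segment in `Q` or in `P`. -/
structure IsTrajectory (d : ℂ) (s : ℤ → Fin 5) (p : ℤ → ℂ) : Prop where
  mem_side : ∀ n, p n ∈ openSegment ℝ (vertex (s n)) (vertex (s n + 1))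
  side_ne : ∀ n, s (n + 1) ≠ s n
  segment_Q : ∀ n, Even n → ∃ t : ℝ, 0 < t ∧
    p (n + 1) - sideShift (s (n + 1)) = p n - sideShift (s n) + (t : ℂ) * d
  segment_P : ∀ n, Odd n → ∃ t : ℝ, 0 < t ∧ p (n + 1) = p n + (t : ℂ) * d

/-- The symbolic orbits in the direction with coordinate `x`: the sequences of the labels of the
sides that are consecutively crossed. -/
def sideWords (x : ℝ) : Set (ℤ → Fin 5) :=
  {s | ∃ p : ℤ → ℂ, IsTrajectory (direction x) s p}

/-- The symbolic orbits in the interval exchange model. The section is the horizontal diagonal of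
`P`; a trajectory in a direction with a real coordinate crosses it once in every passage through
`P`. The intervals exchanged by the first return map consist of the points from which a trajectory
crosses the same two sides (first from `P` to `Q`, then from `Q` to `P`) before it returns to the
section, so an interval is labelled by this pair of sides. -/
def intervalWords (x : ℝ) : Set (ℤ → Fin 5 × Fin 5) :=
  {w | ∃ s ∈ sideWords x, ∀ n, w n = (s (2 * n), s (2 * n + 1))}

/-! ### Periods -/

/-- `q` is the (least positive) period of the bi-infinite word `w`. -/
def HasPeriod {S : Type} (w : ℤ → S) (q : ℕ) : Prop :=
  IsLeast {r : ℕ | 0 < r ∧ Function.Periodic w (r : ℤ)} q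

/-- Two words are the same symbolic orbit, that is, they differ by a shift. -/
def SameOrbit {S : Type} (w w' : ℤ → S) : Prop :=
  ∃ m : ℤ, ∀ n, w' n = w (n + m)

/-- The words in `W` form exactly two symbolic orbits (one for each of the two strips of parallel
periodic trajectories), both are periodic, and `a ≤ A` are their periods. This determines `a`
and `A`. -/
def IsPeriodPair {S : Type} (W : Set (ℤ → S)) (a A : ℕ) : Prop :=
  a ≤ A ∧ ∃ w ∈ W, ∃ w' ∈ W, HasPeriod w a ∧ HasPeriod w' A ∧ ¬ SameOrbit w w' ∧
    ∀ u ∈ W, SameOrbit w u ∨ SameOrbit w' u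

/-- The integer `c i`, multiplied by `-1` if `i < 0`. -/
def signed (c : ℤ → ℕ) (i : ℤ) : ℤ := if i < 0 then -(c i : ℤ) else (c i : ℤ)

end DoublePentagon

end

noncomputable section

namespace DoublePentagon

/-! ### A four-interval exchange and its renormalization -/

/-! For directions between `φ / 2 - 1` and `1 - φ / 2` the return map to the horizontal diagonal
exchanges four intervals of lengths `φ s, t, s, φ t`, where `s, t ≥ 0` are linear coordinates of the
direction (`intervalWords_eq`). This family is self-similar: for each of four linear maps of `(s,
t)` (`Move.act`), the exchange with the new parameters induces the exchange with the old ones on a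
subinterval, and itineraries change by a substitution (`Move.path_subst`, `Lengths.inflate_ofPair`).

For `(s, t) = (1, 0)` or `(0, 1)` the exchange is the identity on two intervals, of lengths `1` and
`φ`, and these are the two strips. Induction transports both strips with their widths, so after any
product of moves the vector of lengths is the letter counts of the first periodic word plus `φ`
times those of the second; this is the invariant of `Lengths.Good`. Summing the four letters gives
`a + A φ = φ ^ 2 (s + t)` for the pair of periods. The word lengths are least periods because the
letter counts have no common divisor, a property kept by the unimodular count matrices of the
substitutions.

On the tiling side, in the same linear coordinates `T` and `R` become `rot` and `refl`, and sides of
ideal pentagons are images of the standard basis (`Frame`). Up to swapping coordinates and signs,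
the four moves are `refl` after the four nontrivial powers of `rot`. Hence every frame is, up to
signs and order, a rotated product of moves (`Frame.placed`), and a frame vector in the first
quadrant is `Good` (`Adj.good`).

If `(v, u)` is a frame and `v` represents `β`, the points joined to `β` are exactly those
represented by `u + k φ v` for `k ∈ ℤ` (`Frame.joinedBySide_iff`). The sum of coordinates increases
by `φ (v.1 + v.2)` from each one to the next, so the signed number `c + C φ` increases by `φ (b + B
φ) = B + (b + B) φ`. Irrationality of `φ` separates the coefficients. Vectors with negative sum
represent the points on the other side of `β` and must be negated to enter the first quadrant, hence
the sign `-1` for `i < 0`.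

Side words alternate between the exits and the entrances of `P`, so their periods are twice those of
interval words, which preserves the arithmetic law. -/

/-- Labels of the four exchanged intervals. -/
inductive Letter
  | a | b | c | d
  deriving DecidableEq

/-- The lengths of the four exchanged intervals. -/
structure Lengths where
  a : ℝ
  b : ℝ
  c : ℝ
  d : ℝ

namespace Lengths

/-- The total length. -/
def total (l : Lengths) : ℝ := l.a + l.b + l.c + l.d

/-- All lengths are nonnegative. -/
def Nonneg (l : Lengths) : Prop := 0 ≤ l.a ∧ 0 ≤ l.b ∧ 0 ≤ l.c ∧ 0 ≤ l.d

/-- Left ends of the exchanged intervals, which are placed in the order `a b c d`. -/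
def lo (l : Lengths) : Letter → ℝ
  | .a => 0
  | .b => l.a
  | .c => l.a + l.b
  | .d => l.a + l.b + l.c

/-- Right ends of the exchanged intervals. -/
def hi (l : Lengths) : Letter → ℝ
  | .a => l.a
  | .b => l.a + l.b
  | .c => l.a + l.b + l.c
  | .d => l.a + l.b + l.c + l.d

/-- The translations that put the intervals in the order `b d a c`. -/
def sh (l : Lengths) : Letter → ℝ
  | .a => l.b + l.d
  | .b => -l.a
  | .c => l.d
  | .d => -(l.a + l.c)

/-- The forward orbit `u` of the interval exchange and its itinerary `w`. -/
def IsOrbit (l : Lengths) (u : ℕ → ℝ) (w : ℕ → Letter) : Prop :=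
  ∀ n, (l.lo (w n) < u n ∧ u n < l.hi (w n)) ∧ u (n + 1) = u n + l.sh (w n)

/-- The itineraries of the two-sided orbits. -/
def words (l : Lengths) : Set (ℤ → Letter) :=
  {w | ∃ u : ℤ → ℝ, ∀ n, (l.lo (w n) < u n ∧ u n < l.hi (w n)) ∧ u (n + 1) = u n + l.sh (w n)}

/-- The orbit of `v` follows the itinerary `L` and arrives at `v'`. -/
def Path (l : Lengths) : ℝ → List Letter → ℝ → Prop
  | v, [], v' => v = v'
  | v, x :: L, v' => (l.lo x < v ∧ v < l.hi x) ∧ Path l (v + l.sh x) L v'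

end Lengths

/-- The four renormalization steps. -/
inductive Move
  | one | two | three | four

namespace Move

/-- The substitution of a renormalization step. -/
def subst : Move → Letter → List Letter
  | one, .a => [.a]
  | one, .b => [.b, .a]
  | one, .c => [.c]
  | one, .d => [.c, .d, .a]
  | two, .a => [.a, .c, .d]
  | two, .b => [.a, .d]
  | two, .c => [.b, .a]
  | two, .d => [.b, .a, .c, .d]
  | three, .a => [.c, .d, .b, .a]
  | three, .b => [.c, .d]
  | three, .c => [.d, .a]
  | three, .d => [.d, .b, .a]
  | four, .a => [.b, .a, .d]
  | four, .b => [.b]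
  | four, .c => [.c, .d]
  | four, .d => [.d]

/-- The lengths of the interval exchange that renormalizes to the one with lengths `l`. -/
def inflate : Move → Lengths → Lengths
  | one, l => ⟨l.a + l.b + l.d, l.b, l.c + l.d, l.d⟩
  | two, l => ⟨l.a + l.b + l.c + l.d, l.c + l.d, l.a + l.d, l.a + l.b + l.d⟩
  | three, l => ⟨l.a + l.c + l.d, l.a + l.d, l.a + l.b, l.a + l.b + l.c + l.d⟩
  | four, l => ⟨l.a, l.a + l.b, l.c, l.a + l.c + l.d⟩

/-- The left end of the interval of induction. -/
def offset : Move → Lengths → ℝ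
  | one, l => l.b + l.d
  | two, l => l.c + l.d
  | three, l => 2 * l.a + l.c + 2 * l.d
  | four, l => l.a

theorem inflate_nonneg (m : Move) {l : Lengths} (hl : l.Nonneg) : (m.inflate l).Nonneg := by
  obtain ⟨h1, h2, h3, h4⟩ := hl
  cases m <;> refine ⟨?_, ?_, ?_, ?_⟩ <;> simp only [inflate] <;> linarith

theorem subst_length_pos (m : Move) (x : Letter) : 0 < (m.subst x).length := by
  cases m <;> cases x <;> simp [subst]

theorem subst_length_le (m : Move) (x : Letter) : (m.subst x).length ≤ 4 := by
  cases m <;> cases x <;> simp [subst]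

/-- The heart of the renormalization: the exchange `l`, translated by the offset, is induced by the
inflated one, and a point of the cell `x` follows the word `m.subst x` on its way back. -/
theorem path_subst (m : Move) {l : Lengths} (hl : l.Nonneg) (x : Letter) {v : ℝ}
    (hv : l.lo x < v ∧ v < l.hi x) :
    (m.inflate l).Path (v + m.offset l) (m.subst x) (v + l.sh x + m.offset l) := by
  obtain ⟨h1, h2, h3, h4⟩ := hl
  obtain ⟨h5, h6⟩ := hv
  cases m <;> cases x <;>
    simp only [subst, Lengths.Path, inflate, offset, Lengths.lo, Lengths.hi, Lengths.sh]
      at h5 h6 ⊢ <;>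
    and_intros <;> first | trivial | linarith

theorem orbit_cases {l : Lengths} {u : ℕ → ℝ} {w : ℕ → Letter} (h : l.IsOrbit u w) (n : ℕ) :
    (0 < u n ∧ u n < l.a ∧ u (n + 1) = u n + l.b + l.d) ∨
    (l.a < u n ∧ u n < l.a + l.b ∧ u (n + 1) = u n - l.a) ∨
    (l.a + l.b < u n ∧ u n < l.a + l.b + l.c ∧ u (n + 1) = u n + l.d) ∨
    (l.a + l.b + l.c < u n ∧ u n < l.a + l.b + l.c + l.d ∧ u (n + 1) = u n - l.a - l.c) := by
  obtain ⟨⟨h1, h2⟩, h3⟩ := h n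
  cases hw : w n <;> rw [hw] at h1 h2 h3 <;>
    simp only [Lengths.lo, Lengths.hi, Lengths.sh] at h1 h2 h3
  · exact Or.inl ⟨h1, h2, by linarith⟩
  · exact Or.inr (Or.inl ⟨h1, h2, by linarith⟩)
  · exact Or.inr (Or.inr (Or.inl ⟨h1, h2, by linarith⟩))
  · exact Or.inr (Or.inr (Or.inr ⟨h1, h2, by linarith⟩))

/-- A point of the interval of induction whose orbit avoids the discontinuities is not a
discontinuity of the induced map. -/
theorem exists_cell (m : Move) {l : Lengths} (hl : l.Nonneg) {u : ℕ → ℝ} {w : ℕ → Letter}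
    (h : (m.inflate l).IsOrbit u w) (h0 : 0 < u 0 - m.offset l) (h1 : u 0 - m.offset l < l.total) :
    ∃ x, l.lo x < u 0 - m.offset l ∧ u 0 - m.offset l < l.hi x := by
  obtain ⟨ha, hb, hc, hd⟩ := hl
  -- An orbit of the large exchange that starts at a division point of the induced one violates the
  -- strict cell inequalities at one of its first three points.
  have hs : u 0 - m.offset l ≠ l.a ∧ u 0 - m.offset l ≠ l.a + l.b ∧
      u 0 - m.offset l ≠ l.a + l.b + l.c := by
    have c0 := orbit_cases h 0
    have c1 := orbit_cases h 1
    have c2 := orbit_cases h 2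
    simp only [Nat.reduceAdd] at c0 c1 c2
    cases m <;> simp only [inflate, offset, Lengths.total] at * <;>
      refine ⟨fun e => ?_, fun e => ?_, fun e => ?_⟩ <;>
      (rcases c0 with ⟨_, _, _⟩ | ⟨_, _, _⟩ | ⟨_, _, _⟩ | ⟨_, _, _⟩ <;> try linarith) <;>
      (rcases c1 with ⟨_, _, _⟩ | ⟨_, _, _⟩ | ⟨_, _, _⟩ | ⟨_, _, _⟩ <;> try linarith) <;>
      (rcases c2 with ⟨_, _, _⟩ | ⟨_, _, _⟩ | ⟨_, _, _⟩ | ⟨_, _, _⟩ <;> linarith)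
  obtain ⟨n1, n2, n3⟩ := hs
  rcases lt_or_gt_of_ne n1 with g1 | g1
  · exact ⟨.a, h0, g1⟩
  rcases lt_or_gt_of_ne n2 with g2 | g2
  · exact ⟨.b, g1, g2⟩
  rcases lt_or_gt_of_ne n3 with g3 | g3
  · exact ⟨.c, g2, g3⟩
  · exact ⟨.d, g3, h1⟩

/-- Every orbit soon enters the interval of induction. -/
theorem exists_entry (m : Move) {l : Lengths} (hl : l.Nonneg) {u : ℕ → ℝ} {w : ℕ → Letter}
    (h : (m.inflate l).IsOrbit u w) :
    ∃ n ≤ 3, 0 < u n - m.offset l ∧ u n - m.offset l < l.total := by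
  obtain ⟨ha, hb, hc, hd⟩ := hl
  have c0 := orbit_cases h 0
  have c1 := orbit_cases h 1
  have c2 := orbit_cases h 2
  have c3 := orbit_cases h 3
  by_contra! H
  have e : ∀ n ≤ 3, u n - m.offset l ≤ 0 ∨ l.total ≤ u n - m.offset l := fun n hn =>
    (le_or_gt (u n - m.offset l) 0).imp_right (H n hn)
  have e0 := e 0 (by norm_num)
  have e1 := e 1 (by norm_num)
  have e2 := e 2 (by norm_num)
  have e3 := e 3 (by norm_num)
  clear e H
  simp only [Nat.reduceAdd] at c0 c1 c2 c3
  cases m <;> simp only [inflate, offset, Lengths.total] at c0 c1 c2 c3 e0 e1 e2 e3 <;>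
    (rcases e0 with e0 | e0 <;>
      rcases c0 with ⟨_, _, _⟩ | ⟨_, _, _⟩ | ⟨_, _, _⟩ | ⟨_, _, _⟩ <;> try linarith) <;>
    (rcases e1 with e1 | e1 <;>
      rcases c1 with ⟨_, _, _⟩ | ⟨_, _, _⟩ | ⟨_, _, _⟩ | ⟨_, _, _⟩ <;> try linarith) <;>
    (rcases e2 with e2 | e2 <;>
      rcases c2 with ⟨_, _, _⟩ | ⟨_, _, _⟩ | ⟨_, _, _⟩ | ⟨_, _, _⟩ <;> try linarith) <;>
    (rcases e3 with e3 | e3 <;>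
      rcases c3 with ⟨_, _, _⟩ | ⟨_, _, _⟩ | ⟨_, _, _⟩ | ⟨_, _, _⟩ <;> linarith)

end Move

/-! ### Itineraries under renormalization -/

/-- The word `w` contains `L` from the place `n` on. -/
def Seg (w : ℕ → Letter) : ℕ → List Letter → Prop
  | _, [] => True
  | n, x :: L => w n = x ∧ Seg w (n + 1) L

theorem seg_append {w : ℕ → Letter} {L' : List Letter} :
    ∀ {n : ℕ} {L : List Letter}, Seg w n (L ++ L') ↔ Seg w n L ∧ Seg w (n + L.length) L'
  | n, [] => by simp [Seg]
  | n, x :: L => by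
    simp only [List.cons_append, Seg, seg_append (L := L), List.length_cons, and_assoc]
    rw [show n + 1 + L.length = n + (L.length + 1) by ring]

theorem seg_shift {w : ℕ → Letter} {k : ℕ} :
    ∀ {n : ℕ} {L : List Letter}, Seg (fun i => w (k + i)) n L ↔ Seg w (k + n) L
  | n, [] => by simp [Seg]
  | n, x :: L => by simp only [Seg, seg_shift (L := L), add_assoc]

theorem seg_iff {w : ℕ → Letter} :
    ∀ {n : ℕ} {L : List Letter}, Seg w n L ↔ ∀ i (hi : i < L.length), w (n + i) = L[i]
  | n, [] => by simp [Seg]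
  | n, x :: L => by
    rw [Seg, seg_iff]
    constructor
    · rintro ⟨h1, h2⟩ i hi
      cases i with
      | zero => simpa using h1
      | succ i =>
        have := h2 i (by simpa using hi)
        rw [show n + (i + 1) = n + 1 + i by ring]
        simpa using this
    · intro h
      refine ⟨h 0 (Nat.succ_pos _), fun i hi => ?_⟩
      have := h (i + 1) (by simpa using hi)
      rw [show n + (i + 1) = n + 1 + i by ring] at this
      simpa using this

/-- From the place `n` on, the word `w` is the periodic repetition of `L`. -/
def Follows (w : ℕ → Letter) (n : ℕ) (L : List Letter) : Prop :=
  ∀ m, Seg w (n + m * L.length) L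

theorem follows_shift {w : ℕ → Letter} {k n : ℕ} {L : List Letter} :
    Follows (fun i => w (k + i)) n L ↔ Follows w (k + n) L := by
  simp only [Follows, seg_shift, add_assoc]

/-! ### Paths, the induced map and the transport of periodic itineraries -/

namespace Lengths

variable {l : Lengths}

theorem IsOrbit.shift {u : ℕ → ℝ} {w : ℕ → Letter} (h : l.IsOrbit u w) (n : ℕ) :
    l.IsOrbit (fun i => u (n + i)) (fun i => w (n + i)) :=
  fun k => h (n + k)

theorem cell_unique (hl : l.Nonneg) {v : ℝ} {x y : Letter} (hx : l.lo x < v ∧ v < l.hi x)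
    (hy : l.lo y < v ∧ v < l.hi y) : x = y := by
  obtain ⟨ha, hb, hc, hd⟩ := hl
  obtain ⟨h1, h2⟩ := hx
  obtain ⟨h3, h4⟩ := hy
  cases x <;> cases y <;> first | rfl | (simp only [lo, hi] at *; linarith)

theorem cell_sh (hl : l.Nonneg) {v : ℝ} {x : Letter} (hx : l.lo x < v ∧ v < l.hi x) :
    0 < v + l.sh x ∧ v + l.sh x < l.total := by
  obtain ⟨ha, hb, hc, hd⟩ := hl
  obtain ⟨h1, h2⟩ := hx
  cases x <;> simp only [lo, hi, sh, total] at * <;> constructor <;> linarith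

theorem path_append {L' : List Letter} {v'' : ℝ} :
    ∀ {v v' : ℝ} {L : List Letter}, l.Path v L v' → l.Path v' L' v'' → l.Path v (L ++ L') v''
  | v, v', [], h, h' => by
    rw [Path] at h
    rwa [h]
  | v, v', x :: L, h, h' => ⟨h.1, path_append h.2 h'⟩

/-- The open cells are disjoint, so a path from a point of an orbit determines the itinerary of the
orbit. -/
theorem path_seg (hl : l.Nonneg) {u : ℕ → ℝ} {w : ℕ → Letter} (h : l.IsOrbit u w) {v' : ℝ} :
    ∀ {n : ℕ} {L : List Letter}, l.Path (u n) L v' → Seg w n L ∧ u (n + L.length) = v'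
  | n, [], hp => ⟨trivial, hp⟩
  | n, x :: L, hp => by
    have hx : w n = x := cell_unique hl (h n).1 hp.1
    have h2 : l.Path (u (n + 1)) L v' := by
      rw [(h n).2, hx]
      exact hp.2
    obtain ⟨h3, h4⟩ := path_seg hl h h2
    refine ⟨⟨hx, h3⟩, ?_⟩
    rw [List.length_cons, ← h4]
    congr 1
    ring

theorem path_flatMap (m : Move) (hl : l.Nonneg) {v' : ℝ} :
    ∀ {v : ℝ} {L : List Letter}, l.Path v L v' →
      (m.inflate l).Path (v + m.offset l) (L.flatMap m.subst) (v' + m.offset l)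
  | v, [], h => by
    rw [Path] at h
    simp [Path, h]
  | v, x :: L, h => by
    rw [List.flatMap_cons]
    exact path_append (m.path_subst hl x h.1) (path_flatMap m hl h.2)

/-- The orbit of the induced map, with the times of return to the interval of induction. -/
theorem IsOrbit.exists_induced (m : Move) (hl : l.Nonneg) {u : ℕ → ℝ} {w : ℕ → Letter}
    (h : (m.inflate l).IsOrbit u w) (h0 : 0 < u 0 - m.offset l ∧ u 0 - m.offset l < l.total) :
    ∃ (u' : ℕ → ℝ) (w' : ℕ → Letter) (r : ℕ → ℕ), l.IsOrbit u' w' ∧ r 0 = 0 ∧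
      ∀ j, r (j + 1) = r j + (m.subst (w' j)).length ∧ Seg w (r j) (m.subst (w' j)) := by
  let P : ℕ → Prop := fun n => 0 < u n - m.offset l ∧ u n - m.offset l < l.total
  have step : ∀ n : {n // P n}, ∃ (n' : {n // P n}) (x : Letter),
      (l.lo x < u n - m.offset l ∧ u n - m.offset l < l.hi x) ∧
      u n' - m.offset l = u n - m.offset l + l.sh x ∧
      n'.1 = n.1 + (m.subst x).length ∧ Seg w n (m.subst x) := by
    rintro ⟨n, hn⟩
    obtain ⟨x, hx⟩ := m.exists_cell hl (h.shift n) hn.1 hn.2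
    have hp := m.path_subst hl x hx
    simp only [add_zero, sub_add_cancel] at hp hx
    obtain ⟨h1, h2⟩ := path_seg (m.inflate_nonneg hl) h hp
    have h3 : u (n + (m.subst x).length) - m.offset l = u n - m.offset l + l.sh x := by
      rw [h2]
      ring
    refine ⟨⟨n + (m.subst x).length, ?_⟩, x, hx, h3, rfl, h1⟩
    show 0 < _ ∧ _
    rw [h3]
    exact cell_sh hl hx
  choose nx lt h1 h2 h3 h4 using step
  -- `nx` sends a visit to the interval of induction to the next one given by the substitution; its
  -- iterates are the return times.
  let r : ℕ → {n // P n} := fun j => nx^[j] ⟨0, h0⟩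
  have hr : ∀ j, r (j + 1) = nx (r j) := fun j => Function.iterate_succ_apply' _ _ _
  refine ⟨fun j => u (r j) - m.offset l, fun j => lt (r j), fun j => r j, fun j => ⟨h1 _, ?_⟩,
    rfl, fun j => ⟨?_, h4 _⟩⟩
  · show u (r (j + 1)) - _ = _
    rw [hr, h2]
  · show (r (j + 1) : ℕ) = _
    rw [hr, h3]

/-- The orbits of the interval exchange follow the periodic itineraries `L₁` and `L₂`. -/
structure Coded (l : Lengths) (L₁ L₂ : List Letter) : Prop where
  ne₁ : L₁ ≠ []
  ne₂ : L₂ ≠ []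
  path₁ : ∃ v, l.Path v L₁ v
  path₂ : ∃ v, l.Path v L₂ v
  follows : ∃ R, ∀ u w, l.IsOrbit u w → ∃ n ≤ R, Follows w n L₁ ∨ Follows w n L₂

theorem seg_subst {m : Move} {w w' : ℕ → Letter} {r : ℕ → ℕ}
    (hr : ∀ j, r (j + 1) = r j + (m.subst (w' j)).length ∧ Seg w (r j) (m.subst (w' j))) :
    ∀ {n : ℕ} {L : List Letter}, Seg w' n L →
      Seg w (r n) (L.flatMap m.subst) ∧ r (n + L.length) = r n + (L.flatMap m.subst).length
  | n, [], _ => by simp [Seg]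
  | n, x :: L, h => by
    obtain ⟨h1, h2⟩ := h
    obtain ⟨h3, h4⟩ := seg_subst hr h2
    obtain ⟨h5, h6⟩ := hr n
    rw [h1] at h5 h6
    rw [List.flatMap_cons, seg_append, ← h5, List.length_append, List.length_cons, ← add_assoc,
      ← add_assoc, ← h5, ← h4]
    refine ⟨⟨h6, h3⟩, ?_⟩
    congr 1
    ring

theorem follows_subst {m : Move} {w w' : ℕ → Letter} {r : ℕ → ℕ}
    (hr : ∀ j, r (j + 1) = r j + (m.subst (w' j)).length ∧ Seg w (r j) (m.subst (w' j)))
    {n : ℕ} {L : List Letter} (h : Follows w' n L) : Follows w (r n) (L.flatMap m.subst) := by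
  -- Each period of the induced word takes the same time in the large exchange.
  have key : ∀ k, r (n + k * L.length) = r n + k * (L.flatMap m.subst).length := by
    intro k
    induction k with
    | zero => simp
    | succ k ih =>
      rw [add_mul, one_mul, ← add_assoc, (seg_subst hr (h k)).2, ih]
      ring
  intro k
  rw [← key]
  exact (seg_subst hr (h k)).1

theorem Coded.inflate (m : Move) (hl : l.Nonneg) {L₁ L₂ : List Letter} (h : l.Coded L₁ L₂) :
    (m.inflate l).Coded (L₁.flatMap m.subst) (L₂.flatMap m.subst) := by
  have ne : ∀ L : List Letter, L ≠ [] → L.flatMap m.subst ≠ [] := by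
    intro L hL
    cases L with
    | nil => exact absurd rfl hL
    | cons x L =>
      intro e
      have := m.subst_length_pos x
      simp_all
  obtain ⟨R, hR⟩ := h.follows
  -- At most `3` steps to enter the interval of induction, then at most `4` for each of at most `R`
  -- induced steps. That the bound does not depend on the orbit is what later makes two-sided words
  -- periodic.
  refine ⟨ne _ h.ne₁, ne _ h.ne₂, ?_, ?_, 3 + 4 * R, fun u w hu => ?_⟩
  · obtain ⟨v, hv⟩ := h.path₁
    exact ⟨_, path_flatMap m hl hv⟩
  · obtain ⟨v, hv⟩ := h.path₂
    exact ⟨_, path_flatMap m hl hv⟩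
  · obtain ⟨n, hn, h0⟩ := m.exists_entry hl hu
    obtain ⟨u', w', r, h1, h2, h3⟩ := (hu.shift n).exists_induced m hl h0
    obtain ⟨k, hk, hf⟩ := hR u' w' h1
    have hrk : ∀ j, r j ≤ 4 * j := by
      intro j
      induction j with
      | zero => simp [h2]
      | succ j ih =>
        rw [(h3 j).1]
        have := m.subst_length_le (w' j)
        omega
    refine ⟨n + r k, ?_, ?_⟩
    · have := hrk k
      omega
    · exact hf.imp (fun g => follows_shift.1 (follows_subst h3 g))
        (fun g => follows_shift.1 (follows_subst h3 g))

/-! ### Two-sided orbits -/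

/-- The two-sided periodic repetition of `L`. -/
def perWord (L : List Letter) (k : ℤ) : Letter := L.getD (k % L.length).toNat .a

theorem perWord_periodic (L : List Letter) : Function.Periodic (perWord L) (L.length : ℤ) := by
  intro k
  simp [perWord]

theorem path_take {v' : ℝ} : ∀ {v : ℝ} {L : List Letter}, l.Path v L v' →
    v + (L.map l.sh).sum = v' ∧ ∀ i (hi : i < L.length),
      l.lo L[i] < v + ((L.take i).map l.sh).sum ∧ v + ((L.take i).map l.sh).sum < l.hi L[i]
  | v, [], h => by
    rw [Path] at h
    simp [h]
  | v, x :: L, h => by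
    obtain ⟨h1, h2⟩ := path_take h.2
    refine ⟨by simpa [add_assoc] using h1, fun i hi => ?_⟩
    cases i with
    | zero => simpa using h.1
    | succ i => simpa [add_assoc] using h2 i (by simpa using hi)

theorem perWord_mem {L : List Letter} (hL : L ≠ []) {v : ℝ} (h : l.Path v L v) (k : ℤ) :
    (fun n => perWord L (n + k)) ∈ l.words := by
  have hpos : 0 < (L.length : ℤ) := by
    have := List.length_pos_iff.2 hL
    omega
  obtain ⟨h1, h2⟩ := path_take h
  -- The residue either increases by one or wraps to `0`; at the wrap the orbit closes because the
  -- translations along `L` sum to zero.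
  have key : ∀ n : ℤ, ∃ i : ℕ, ∃ hi : i < L.length, (n % L.length).toNat = i ∧
      ((i + 1 < L.length ∧ ((n + 1) % L.length).toNat = i + 1) ∨
       (i + 1 = L.length ∧ ((n + 1) % L.length).toNat = 0)) := by
    intro n
    have e1 := Int.emod_nonneg n hpos.ne'
    have e2 := Int.emod_lt_of_pos n hpos
    refine ⟨(n % L.length).toNat, by omega, rfl, ?_⟩
    have e3 : (n + 1) % L.length = (n % L.length + 1) % L.length := by
      rw [Int.emod_add_emod]
    rcases lt_or_ge (n % L.length + 1) L.length with g | g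
    · rw [Int.emod_eq_of_lt (by omega) g] at e3
      left
      omega
    · have g' : n % L.length + 1 = L.length := by omega
      rw [g', Int.emod_self] at e3
      right
      omega
  refine ⟨fun n => v + ((L.take ((n + k) % L.length).toNat).map l.sh).sum, fun n => ?_⟩
  obtain ⟨i, hi, h3, h4⟩ := key (n + k)
  have h5 : perWord L (n + k) = L[i] := by
    rw [perWord, h3, List.getD_eq_getElem _ _ hi]
  simp only [h5, h3]
  refine ⟨h2 i hi, ?_⟩
  have h6 : ((L.take (i + 1)).map l.sh).sum = ((L.take i).map l.sh).sum + l.sh L[i] := by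
    rw [List.take_succ_eq_append_getElem hi, List.map_append, List.sum_append]
    simp
  rw [show n + 1 + k = n + k + 1 by ring]
  rcases h4 with ⟨_, h4⟩ | ⟨h4', h4⟩
  · rw [h4, h6]
    ring
  · rw [h4]
    rw [h4', List.take_length] at h6
    simp only [List.take_zero, List.map_nil, List.sum_nil]
    linarith

/-- A two-sided word can be cut at an arbitrarily early time, and it becomes periodic within `R`
places of the cut, so it is periodic everywhere. -/
theorem Coded.mem_words {L₁ L₂ : List Letter} (h : l.Coded L₁ L₂) {w : ℤ → Letter} :
    w ∈ l.words ↔ ∃ k : ℤ, (∀ n, w n = perWord L₁ (n + k)) ∨ (∀ n, w n = perWord L₂ (n + k)) := by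
  constructor
  swap
  · rintro ⟨k, hk | hk⟩
    · obtain ⟨v, hv⟩ := h.path₁
      rw [show w = fun n => perWord L₁ (n + k) from funext hk]
      exact perWord_mem h.ne₁ hv k
    · obtain ⟨v, hv⟩ := h.path₂
      rw [show w = fun n => perWord L₂ (n + k) from funext hk]
      exact perWord_mem h.ne₂ hv k
  rintro ⟨u, hu⟩
  obtain ⟨R, hR⟩ := h.follows
  have H : ∀ N : ℤ, ∃ n ≤ R, Follows (fun i => w (N + i)) n L₁ ∨ Follows (fun i => w (N + i)) n L₂ := by
    intro N
    refine hR (fun i => u (N + i)) _ fun i => ⟨(hu _).1, ?_⟩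
    rw [← (hu _).2]
    show u (N + ((i + 1 : ℕ) : ℤ)) = u (N + i + 1)
    congr 1
    push_cast
    ring
  have fin : ∀ L : List Letter, L ≠ [] →
      (∀ N : ℤ, ∃ N' ≤ N, ∃ n ≤ R, Follows (fun i => w (N' + i)) n L) →
      ∃ k : ℤ, ∀ n, w n = perWord L (n + k) := by
    intro L hL hN
    have hpos : 0 < L.length := List.length_pos_iff.2 hL
    have key : ∀ (N : ℤ) (n : ℕ), Follows (fun i => w (N + i)) n L →
        ∀ j : ℕ, w (N + n + j) = perWord L j := by
      intro N n hf j
      have h1 := seg_iff.1 (hf (j / L.length)) (j % L.length) (Nat.mod_lt _ hpos)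
      have h2 : n + j / L.length * L.length + j % L.length = n + j := by
        rw [add_assoc, Nat.div_add_mod']
      rw [h2] at h1
      rw [perWord, ← Int.natCast_mod, Int.toNat_natCast,
        List.getD_eq_getElem _ _ (Nat.mod_lt _ hpos), ← h1]
      congr 1
      push_cast
      ring
    have per : Function.Periodic w (L.length : ℤ) := by
      intro k
      obtain ⟨N, hNk, n, hn, hf⟩ := hN (k - R)
      obtain ⟨j, hj⟩ := Int.eq_ofNat_of_zero_le (show 0 ≤ k - (N + n) by omega)
      have e1 := key N n hf j
      have e2 := key N n hf (j + L.length)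
      push_cast at e2
      rw [perWord_periodic] at e2
      rw [show k = N + n + j by omega, e1, ← e2]
      congr 1
      ring
    obtain ⟨N, _, n, hn, hf⟩ := hN 0
    refine ⟨-(N + n), fun k => ?_⟩
    have e1 := key N n hf ((k - (N + n)) % L.length).toNat
    have e2 : (((k - (N + n)) % L.length).toNat : ℤ) = (k - (N + n)) % L.length :=
      Int.toNat_of_nonneg (Int.emod_nonneg _ (by omega))
    rw [e2] at e1
    have e3 := Int.emod_add_mul_ediv (k - (N + n)) L.length
    have e4 : w k = w (N + n + (k - (N + n)) % L.length) := by
      have := per.int_mul ((k - (N + n)) / L.length) (N + n + (k - (N + n)) % L.length)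
      rw [← this]
      congr 1
      rw [Int.cast_id]
      linarith
    have e5 : perWord L ((k - (N + n)) % L.length) = perWord L (k - (N + n)) := by
      simp [perWord]
    rw [e4, e1, e5, sub_eq_add_neg]
  -- One of the two lists must occur for arbitrarily early cuts: if `L₁` does not, then `L₂` occurs
  -- for all early ones.
  by_cases c : ∀ N : ℤ, ∃ N' ≤ N, ∃ n ≤ R, Follows (fun i => w (N' + i)) n L₁
  · obtain ⟨k, hk⟩ := fin L₁ h.ne₁ c
    exact ⟨k, Or.inl hk⟩
  · push Not at c
    obtain ⟨N₀, hN₀⟩ := c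
    obtain ⟨k, hk⟩ := fin L₂ h.ne₂ fun N => by
      obtain ⟨n, hn, hf⟩ := H (min N N₀)
      exact ⟨min N N₀, min_le_left _ _, n, hn,
        hf.resolve_left (hN₀ _ (min_le_right _ _) n hn)⟩
    exact ⟨k, Or.inr hk⟩

end Lengths

/-! ### Periods -/

theorem HasPeriod.dvd {S : Type} {w : ℤ → S} {q : ℕ} (h : HasPeriod w q) {r : ℤ}
    (hr : Function.Periodic w r) : (q : ℤ) ∣ r := by
  obtain ⟨⟨h1, h2⟩, h3⟩ := h
  have e : Function.Periodic w (r % q) := by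
    have := hr.sub_period (h2.int_mul (r / q))
    rwa [Int.cast_id, show r - r / q * (q : ℤ) = r % q by
      have := Int.emod_add_mul_ediv r q
      linarith] at this
  by_contra hd
  have p1 := Int.emod_nonneg r (show (q : ℤ) ≠ 0 by omega)
  have p2 := Int.emod_lt_of_pos r (show (0 : ℤ) < q by omega)
  have p3 : r % q ≠ 0 := fun e0 => hd (Int.dvd_of_emod_eq_zero e0)
  have := h3 (show (r % q).toNat ∈ _ from ⟨by omega, by rwa [Int.toNat_of_nonneg p1]⟩)
  omega

theorem HasPeriod.unique {S : Type} {w : ℤ → S} {q r : ℕ} (h : HasPeriod w q)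
    (h' : HasPeriod w r) : q = r :=
  IsLeast.unique h h'

theorem HasPeriod.of_sameOrbit {S : Type} {w w' : ℤ → S} {q : ℕ} (h : HasPeriod w q)
    (hs : SameOrbit w w') : HasPeriod w' q := by
  obtain ⟨m, hm⟩ := hs
  have key : ∀ r : ℤ, Function.Periodic w' r ↔ Function.Periodic w r := by
    intro r
    constructor
    · intro hr n
      have := hr (n - m)
      rw [hm, hm] at this
      rw [show n - m + r + m = n + r by ring, sub_add_cancel] at this
      exact this
    · intro hr n
      rw [hm, hm, show n + r + m = n + m + r by ring]
      exact hr _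
  unfold HasPeriod
  simp only [key]
  exact h

theorem IsPeriodPair.image {S S' : Type} {f : S → S'} (hf : Function.Injective f)
    {W : Set (ℤ → S)} {a A : ℕ} (h : IsPeriodPair W a A) :
    IsPeriodPair ((fun w n => f (w n)) '' W) a A := by
  have hp : ∀ (w : ℤ → S) (q : ℕ), HasPeriod w q → HasPeriod (fun n => f (w n)) q := by
    intro w q hq
    unfold HasPeriod at hq ⊢
    simpa only [Function.Periodic, hf.eq_iff] using hq
  have hs : ∀ w w' : ℤ → S, SameOrbit (fun n => f (w n)) (fun n => f (w' n)) ↔ SameOrbit w w' := by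
    intro w w'
    simp only [SameOrbit, hf.eq_iff]
  obtain ⟨h1, w, hw, w', hw', h2, h3, h4, h5⟩ := h
  refine ⟨h1, _, ⟨w, hw, rfl⟩, _, ⟨w', hw', rfl⟩, hp _ _ h2, hp _ _ h3, by rwa [hs], ?_⟩
  rintro _ ⟨u, hu, rfl⟩
  simp only [hs]
  exact h5 u hu

/-! ### Letter counts and least periods -/

theorem sum_getD_eq_count (x : Letter) : ∀ L : List Letter,
    ∑ i ∈ Finset.range L.length, (if L.getD i .a = x then 1 else 0) = L.count x
  | [] => by simp
  | y :: L => by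
    rw [List.length_cons, Finset.sum_range_succ', List.count_cons]
    simp only [List.getD_cons_succ, List.getD_cons_zero, sum_getD_eq_count x L, beq_iff_eq]

theorem sum_range_mul_of_periodic {f : ℕ → ℕ} {g : ℕ} (hf : ∀ n, f (n + g) = f n) (q : ℕ) :
    ∑ i ∈ Finset.range (q * g), f i = q * ∑ i ∈ Finset.range g, f i := by
  have h : ∀ q n, f (q * g + n) = f n := by
    intro q n
    induction q with
    | zero => simp
    | succ q ih => rw [add_mul, one_mul, add_right_comm, hf, ih]
  induction q with
  | zero => simp
  | succ q ih => simp only [add_mul, one_mul, Finset.sum_range_add, ih, h]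

namespace Lengths

/-- If the least period is `g` and `L.length = q g`, then `L` is a `q`-fold repetition, so `q`
divides every letter count. -/
theorem perWord_hasPeriod {L : List Letter} (hL : L ≠ [])
    (hp : ∀ m, (∀ x, m ∣ L.count x) → m = 1) : HasPeriod (perWord L) L.length := by
  have hpos : 0 < L.length := List.length_pos_iff.2 hL
  have hex : ∃ r : ℕ, 0 < r ∧ Function.Periodic (perWord L) (r : ℤ) :=
    ⟨_, hpos, perWord_periodic L⟩
  classical
  have hg : HasPeriod (perWord L) (Nat.find hex) :=
    ⟨Nat.find_spec hex, fun r hr => Nat.find_min' hex hr⟩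
  obtain ⟨q, hq⟩ := Int.natCast_dvd_natCast.1 (hg.dvd (perWord_periodic L))
  suffices h : q = 1 by
    rw [h, mul_one] at hq
    rwa [hq]
  refine hp q fun x => ?_
  set g := Nat.find hex
  have e1 : L.count x = ∑ i ∈ Finset.range L.length, (if perWord L i = x then 1 else 0) := by
    rw [← sum_getD_eq_count]
    refine Finset.sum_congr rfl fun i hi => ?_
    rw [Finset.mem_range] at hi
    rw [perWord, ← Int.natCast_mod, Int.toNat_natCast, Nat.mod_eq_of_lt hi]
  rw [e1, hq, mul_comm, sum_range_mul_of_periodic]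
  · exact dvd_mul_right _ _
  · intro n
    rw [Nat.cast_add, hg.1.2]

theorem length_eq_count : ∀ L : List Letter,
    L.length = L.count .a + L.count .b + L.count .c + L.count .d
  | [] => by simp
  | x :: L => by
    rw [List.length_cons, length_eq_count L]
    cases x <;> simp <;> omega

theorem count_one (L : List Letter) :
    (L.flatMap Move.one.subst).count .a = L.count .a + L.count .b + L.count .d ∧
    (L.flatMap Move.one.subst).count .b = L.count .b ∧
    (L.flatMap Move.one.subst).count .c = L.count .c + L.count .d ∧
    (L.flatMap Move.one.subst).count .d = L.count .d := by
  induction L with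
  | nil => simp
  | cons x L ih => cases x <;> simp [Move.subst, ih] <;> omega

theorem count_two (L : List Letter) :
    (L.flatMap Move.two.subst).count .a = L.count .a + L.count .b + L.count .c + L.count .d ∧
    (L.flatMap Move.two.subst).count .b = L.count .c + L.count .d ∧
    (L.flatMap Move.two.subst).count .c = L.count .a + L.count .d ∧
    (L.flatMap Move.two.subst).count .d = L.count .a + L.count .b + L.count .d := by
  induction L with
  | nil => simp
  | cons x L ih => cases x <;> simp [Move.subst, ih] <;> omega

theorem count_three (L : List Letter) :
    (L.flatMap Move.three.subst).count .a = L.count .a + L.count .c + L.count .d ∧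
    (L.flatMap Move.three.subst).count .b = L.count .a + L.count .d ∧
    (L.flatMap Move.three.subst).count .c = L.count .a + L.count .b ∧
    (L.flatMap Move.three.subst).count .d =
      L.count .a + L.count .b + L.count .c + L.count .d := by
  induction L with
  | nil => simp
  | cons x L ih => cases x <;> simp [Move.subst, ih] <;> omega

theorem count_four (L : List Letter) :
    (L.flatMap Move.four.subst).count .a = L.count .a ∧
    (L.flatMap Move.four.subst).count .b = L.count .a + L.count .b ∧
    (L.flatMap Move.four.subst).count .c = L.count .c ∧
    (L.flatMap Move.four.subst).count .d = L.count .a + L.count .c + L.count .d := by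
  induction L with
  | nil => simp
  | cons x L ih => cases x <;> simp [Move.subst, ih] <;> omega

/-- The numbers of letters in the itinerary `L` have no common divisor. -/
def Primitive (L : List Letter) : Prop := ∀ m, (∀ x, m ∣ L.count x) → m = 1

/-- The count matrix of each substitution is invertible over `ℤ`: the old counts are integer
combinations of the new ones, so common divisors descend. -/
theorem Primitive.flatMap (m : Move) {L : List Letter} (h : Primitive L) :
    Primitive (L.flatMap m.subst) := by
  intro k hk
  refine h k ?_
  have ha := hk .a
  have hb := hk .b
  have hc := hk .c
  have hd := hk .d
  suffices H : k ∣ L.count .a ∧ k ∣ L.count .b ∧ k ∣ L.count .c ∧ k ∣ L.count .d by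
    intro x
    cases x
    exacts [H.1, H.2.1, H.2.2.1, H.2.2.2]
  clear hk h
  zify at *
  cases m
  · obtain ⟨e1, e2, e3, e4⟩ := count_one L
    rw [e1] at ha; rw [e2] at hb; rw [e3] at hc; rw [e4] at hd
    push_cast at ha hb hc hd
    refine ⟨?_, hb, ?_, hd⟩
    · have := (ha.sub hb).sub hd
      ring_nf at this
      exact this
    · simpa using hc.sub hd
  · obtain ⟨e1, e2, e3, e4⟩ := count_two L
    rw [e1] at ha; rw [e2] at hb; rw [e3] at hc; rw [e4] at hd
    push_cast at ha hb hc hd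
    refine ⟨?_, ?_, ?_, ?_⟩
    · have := ((ha.sub hd).add hc).sub hb
      ring_nf at this
      exact this
    · have := hd.sub hc
      ring_nf at this
      exact this
    · have := ha.sub hd
      ring_nf at this
      exact this
    · have := (hb.add hd).sub ha
      ring_nf at this
      exact this
  · obtain ⟨e1, e2, e3, e4⟩ := count_three L
    rw [e1] at ha; rw [e2] at hb; rw [e3] at hc; rw [e4] at hd
    push_cast at ha hb hc hd
    refine ⟨?_, ?_, ?_, ?_⟩
    · have := (hc.add ha).sub hd
      ring_nf at this
      exact this
    · have := hd.sub ha
      ring_nf at this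
      exact this
    · have := ha.sub hb
      ring_nf at this
      exact this
    · have := ((hd.sub ha).add hb).sub hc
      ring_nf at this
      exact this
  · obtain ⟨e1, e2, e3, e4⟩ := count_four L
    rw [e1] at ha; rw [e2] at hb; rw [e3] at hc; rw [e4] at hd
    push_cast at ha hb hc hd
    refine ⟨ha, ?_, hc, ?_⟩
    · have := hb.sub ha
      ring_nf at this
      exact this
    · have := (hd.sub ha).sub hc
      ring_nf at this
      exact this

/-! ### The self-similar family of exchanges and its periodic directions -/

/-- The lengths `φ s, t, s, φ t`. -/
def ofPair (s t : ℝ) : Lengths := ⟨Real.goldenRatio * s, t, s, Real.goldenRatio * t⟩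

theorem ofPair_nonneg {s t : ℝ} (hs : 0 ≤ s) (ht : 0 ≤ t) : (ofPair s t).Nonneg :=
  ⟨mul_nonneg Real.goldenRatio_pos.le hs, ht, hs, mul_nonneg Real.goldenRatio_pos.le ht⟩

/-- The direction with parameters `s`, `t` is periodic with two primitive itineraries, whose
numbers of letters are given by the lengths of the exchanged intervals. -/
def Good (s t : ℝ) : Prop :=
  0 ≤ s ∧ 0 ≤ t ∧ ∃ L₁ L₂ : List Letter,
    (ofPair s t).Coded L₁ L₂ ∧ Primitive L₁ ∧ Primitive L₂ ∧
    ∃ s₁ s₂ t₁ t₂ : ℕ, s = s₁ + s₂ * Real.goldenRatio ∧ t = t₁ + t₂ * Real.goldenRatio ∧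
      (L₁.count .a = s₂ ∧ L₁.count .b = t₁ ∧ L₁.count .c = s₁ ∧ L₁.count .d = t₂) ∧
      (L₂.count .a = s₁ + s₂ ∧ L₂.count .b = t₂ ∧ L₂.count .c = s₂ ∧ L₂.count .d = t₁ + t₂)

/-- The cells `b` and `d` are empty and the other two do not move, so every orbit is a fixed point
in `a` or in `c`. -/
theorem good_one_zero : Good 1 0 := by
  have hφ := Real.goldenRatio_pos
  refine ⟨zero_le_one, le_rfl, [.c], [.a], ⟨by simp, by simp, ⟨Real.goldenRatio + 1 / 2, ?_⟩,
    ⟨Real.goldenRatio / 2, ?_⟩, 0, fun u w h => ⟨0, le_rfl, ?_⟩⟩, ?_, ?_, 1, 0, 0, 0, ?_⟩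
  · simp only [Path, lo, hi, sh, ofPair]
    refine ⟨⟨?_, ?_⟩, ?_⟩ <;> linarith
  · simp only [Path, lo, hi, sh, ofPair]
    refine ⟨⟨?_, ?_⟩, ?_⟩ <;> linarith
  · have hn : ∀ n, (w n = .a ∨ w n = .c) ∧ u (n + 1) = u n := by
      intro n
      obtain ⟨⟨h1, h2⟩, h3⟩ := h n
      cases hw : w n <;> rw [hw] at h1 h2 h3 <;>
        simp only [lo, hi, sh, ofPair, mul_zero, mul_one, add_zero] at h1 h2 h3
      · exact ⟨Or.inl rfl, h3⟩
      · exact absurd h1 (not_lt.2 h2.le)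
      · exact ⟨Or.inr rfl, h3⟩
      · exact absurd h1 (not_lt.2 h2.le)
    have hu : ∀ n, u n = u 0 := by
      intro n
      induction n with
      | zero => rfl
      | succ n ih => rw [(hn n).2, ih]
    have hw : ∀ n, w n = w 0 := fun n =>
      cell_unique (ofPair_nonneg zero_le_one le_rfl) (h n).1 (by rw [hu n]; exact (h 0).1)
    rcases (hn 0).1 with h0 | h0
    · exact Or.inr fun m => ⟨(hw _).trans h0, trivial⟩
    · exact Or.inl fun m => ⟨(hw _).trans h0, trivial⟩
  · intro m hm
    simpa using hm .c
  · intro m hm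
    simpa using hm .a
  · simp

theorem good_zero_one : Good 0 1 := by
  have hφ := Real.goldenRatio_pos
  refine ⟨le_rfl, zero_le_one, [.b], [.d], ⟨by simp, by simp, ⟨1 / 2, ?_⟩,
    ⟨1 + Real.goldenRatio / 2, ?_⟩, 0, fun u w h => ⟨0, le_rfl, ?_⟩⟩, ?_, ?_, 0, 0, 1, 0, ?_⟩
  · simp only [Path, lo, hi, sh, ofPair]
    refine ⟨⟨?_, ?_⟩, ?_⟩ <;> linarith
  · simp only [Path, lo, hi, sh, ofPair]
    refine ⟨⟨?_, ?_⟩, ?_⟩ <;> linarith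
  · have hn : ∀ n, (w n = .b ∨ w n = .d) ∧ u (n + 1) = u n := by
      intro n
      obtain ⟨⟨h1, h2⟩, h3⟩ := h n
      cases hw : w n <;> rw [hw] at h1 h2 h3 <;>
        simp only [lo, hi, sh, ofPair, mul_zero, mul_one, add_zero, zero_add, neg_zero]
          at h1 h2 h3
      · exact absurd h1 (not_lt.2 h2.le)
      · exact ⟨Or.inl rfl, h3⟩
      · exact absurd h1 (not_lt.2 h2.le)
      · exact ⟨Or.inr rfl, h3⟩
    have hu : ∀ n, u n = u 0 := by
      intro n
      induction n with
      | zero => rfl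
      | succ n ih => rw [(hn n).2, ih]
    have hw : ∀ n, w n = w 0 := fun n =>
      cell_unique (ofPair_nonneg le_rfl zero_le_one) (h n).1 (by rw [hu n]; exact (h 0).1)
    rcases (hn 0).1 with h0 | h0
    · exact Or.inl fun m => ⟨(hw _).trans h0, trivial⟩
    · exact Or.inr fun m => ⟨(hw _).trans h0, trivial⟩
  · intro m hm
    simpa using hm .b
  · intro m hm
    simpa using hm .d
  · simp

/-- The action of the renormalization steps on the parameters of a direction. -/
def _root_.DoublePentagon.Move.act : Move → ℝ × ℝ → ℝ × ℝ
  | .one, v => (v.1 + Real.goldenRatio * v.2, v.2)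
  | .two, v => (Real.goldenRatio * v.1 + Real.goldenRatio * v.2, v.1 + Real.goldenRatio * v.2)
  | .three, v => (Real.goldenRatio * v.1 + v.2, Real.goldenRatio * v.1 + Real.goldenRatio * v.2)
  | .four, v => (v.1, Real.goldenRatio * v.1 + v.2)

/-- The relation `φ ^ 2 = φ + 1` makes the shape `φ s, t, s, φ t` stable under inflation. -/
theorem inflate_ofPair (m : Move) (v : ℝ × ℝ) :
    m.inflate (ofPair v.1 v.2) = ofPair (m.act v).1 (m.act v).2 := by
  have h := Real.goldenRatio_sq
  cases m <;> simp only [Move.inflate, ofPair, Move.act, Lengths.mk.injEq] <;>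
    and_intros <;> first | trivial | rfl | linear_combination v.1 * h | linear_combination -v.1 * h |
      linear_combination v.2 * h | linear_combination -v.2 * h |
      linear_combination (v.1 + v.2) * h | linear_combination -(v.1 + v.2) * h

/-- Letter counts and lengths are transformed by the same integer matrix, so the expansion of the
lengths in the basis `1, φ` stays equal to the two vectors of counts. -/
theorem Good.act (m : Move) {v : ℝ × ℝ} (h : Good v.1 v.2) : Good (m.act v).1 (m.act v).2 := by
  obtain ⟨hs, ht, L₁, L₂, hc, hp₁, hp₂, s₁, s₂, t₁, t₂, es, et, ⟨a1, b1, c1, d1⟩,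
    ⟨a2, b2, c2, d2⟩⟩ := h
  have hφ := Real.goldenRatio_pos
  have hφ2 := Real.goldenRatio_sq
  refine ⟨?_, ?_, _, _, ?_, hp₁.flatMap m, hp₂.flatMap m, ?_⟩
  · cases m <;> simp only [Move.act] <;> positivity
  · cases m <;> simp only [Move.act] <;> positivity
  · rw [← inflate_ofPair]
    exact hc.inflate m (ofPair_nonneg hs ht)
  · cases m
    · obtain ⟨e1, e2, e3, e4⟩ := count_one L₁
      obtain ⟨f1, f2, f3, f4⟩ := count_one L₂
      refine ⟨s₁ + t₂, s₂ + t₁ + t₂, t₁, t₂, ?_, ?_, ⟨?_, ?_, ?_, ?_⟩, ?_, ?_, ?_, ?_⟩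
      · simp only [Move.act, es, et]
        push_cast
        linear_combination (t₂ : ℝ) * hφ2
      · simp only [Move.act, et]
      all_goals omega
    · obtain ⟨e1, e2, e3, e4⟩ := count_two L₁
      obtain ⟨f1, f2, f3, f4⟩ := count_two L₂
      refine ⟨s₂ + t₂, s₁ + s₂ + t₁ + t₂, s₁ + t₂, s₂ + t₁ + t₂, ?_, ?_,
        ⟨?_, ?_, ?_, ?_⟩, ?_, ?_, ?_, ?_⟩
      · simp only [Move.act, es, et]
        push_cast
        linear_combination ((s₂ : ℝ) + t₂) * hφ2
      · simp only [Move.act, es, et]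
        push_cast
        linear_combination (t₂ : ℝ) * hφ2
      all_goals omega
    · obtain ⟨e1, e2, e3, e4⟩ := count_three L₁
      obtain ⟨f1, f2, f3, f4⟩ := count_three L₂
      refine ⟨s₂ + t₁, s₁ + s₂ + t₂, s₂ + t₂, s₁ + s₂ + t₁ + t₂, ?_, ?_,
        ⟨?_, ?_, ?_, ?_⟩, ?_, ?_, ?_, ?_⟩
      · simp only [Move.act, es, et]
        push_cast
        linear_combination (s₂ : ℝ) * hφ2
      · simp only [Move.act, es, et]
        push_cast
        linear_combination ((s₂ : ℝ) + t₂) * hφ2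
      all_goals omega
    · obtain ⟨e1, e2, e3, e4⟩ := count_four L₁
      obtain ⟨f1, f2, f3, f4⟩ := count_four L₂
      refine ⟨s₁, s₂, s₂ + t₁, s₁ + s₂ + t₂, ?_, ?_, ⟨?_, ?_, ?_, ?_⟩, ?_, ?_, ?_, ?_⟩
      · simp only [Move.act, es]
      · simp only [Move.act, es, et]
        push_cast
        linear_combination (s₂ : ℝ) * hφ2
      all_goals omega

theorem words_smul {s t k : ℝ} (hk : 0 < k) :
    (ofPair (k * s) (k * t)).words = (ofPair s t).words := by
  have key : ∀ {s t k : ℝ}, 0 < k → (ofPair s t).words ⊆ (ofPair (k * s) (k * t)).words := by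
    rintro s t k hk w ⟨u, hu⟩
    have hlo : ∀ x, (ofPair (k * s) (k * t)).lo x = k * (ofPair s t).lo x := by
      intro x
      cases x <;> simp only [lo, ofPair] <;> ring
    have hhi : ∀ x, (ofPair (k * s) (k * t)).hi x = k * (ofPair s t).hi x := by
      intro x
      cases x <;> simp only [hi, ofPair] <;> ring
    have hsh : ∀ x, (ofPair (k * s) (k * t)).sh x = k * (ofPair s t).sh x := by
      intro x
      cases x <;> simp only [sh, ofPair] <;> ring
    refine ⟨fun n => k * u n, fun n => ?_⟩
    obtain ⟨⟨h1, h2⟩, h3⟩ := hu n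
    simp only [hlo, hhi, hsh, h3]
    exact ⟨⟨mul_lt_mul_of_pos_left h1 hk, mul_lt_mul_of_pos_left h2 hk⟩, by ring⟩
  refine subset_antisymm ?_ (key hk)
  have := key (s := k * s) (t := k * t) (inv_pos.2 hk)
  rwa [inv_mul_cancel_left₀ hk.ne', inv_mul_cancel_left₀ hk.ne'] at this

theorem perWord_mem_list {L : List Letter} (hL : L ≠ []) (k : ℤ) : perWord L k ∈ L := by
  have hpos : 0 < L.length := List.length_pos_iff.2 hL
  have h1 := Int.emod_nonneg k (show (L.length : ℤ) ≠ 0 by omega)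
  have h2 := Int.emod_lt_of_pos k (show (0 : ℤ) < L.length by omega)
  rw [perWord, List.getD_eq_getElem _ _ (by omega)]
  exact List.getElem_mem _

theorem Good.isPeriodPair {s t : ℝ} (h : Good s t) :
    ∃ a A : ℕ, (a : ℝ) + A * Real.goldenRatio = Real.goldenRatio ^ 2 * (s + t) ∧
      IsPeriodPair (ofPair s t).words a A := by
  obtain ⟨-, -, L₁, L₂, hc, hp₁, hp₂, s₁, s₂, t₁, t₂, es, et, ⟨a1, b1, c1, d1⟩,
    ⟨a2, b2, c2, d2⟩⟩ := h
  have hφ2 := Real.goldenRatio_sq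
  have n1 := length_eq_count L₁
  have n2 := length_eq_count L₂
  have q1 := perWord_hasPeriod hc.ne₁ hp₁
  have q2 := perWord_hasPeriod hc.ne₂ hp₂
  refine ⟨L₁.length, L₂.length, ?_, by omega, perWord L₁, ?_, perWord L₂, ?_, q1, q2, ?_, ?_⟩
  · rw [n1, n2, a1, b1, c1, d1, a2, b2, c2, d2, hφ2, es, et]
    push_cast
    linear_combination -((s₂ : ℝ) + t₂) * hφ2
  · exact hc.mem_words.2 ⟨0, Or.inl fun n => by rw [add_zero]⟩
  · exact hc.mem_words.2 ⟨0, Or.inr fun n => by rw [add_zero]⟩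
  · intro hs
    -- Equal lengths force `s₂ = t₂ = 0`. Then `L₁` uses only `b` and `c`, while `L₂` uses only `a`
    -- and `d`, so the words share no letter.
    have hq := (q1.of_sameOrbit hs).unique q2
    obtain ⟨m, hm⟩ := hs
    have e1 := perWord_mem_list hc.ne₁ (0 + m)
    have e2 := perWord_mem_list hc.ne₂ 0
    rw [hm, ← List.one_le_count_iff] at e2
    rw [← List.one_le_count_iff] at e1
    cases hx : perWord L₁ (0 + m) <;> rw [hx] at e1 e2 <;> omega
  · intro u hu
    obtain ⟨k, hk | hk⟩ := hc.mem_words.1 hu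
    · exact Or.inl ⟨k, hk⟩
    · exact Or.inr ⟨k, hk⟩

end Lengths

/-! ### From trajectories to the interval exchange -/

theorem goldenRatio_bounds : 1.6 < Real.goldenRatio ∧ Real.goldenRatio < 1.62 := by
  have h := Real.goldenRatio_sq
  have h1 := Real.one_lt_goldenRatio
  constructor <;> nlinarith

theorem cos_pi_div_five_eq : Real.cos (Real.pi / 5) = Real.goldenRatio / 2 := by
  rw [Real.cos_pi_div_five, Real.goldenRatio]
  ring

theorem sin_pi_div_five_pos : 0 < Real.sin (Real.pi / 5) :=
  Real.sin_pos_of_pos_of_lt_pi (by positivity) (by linarith [Real.pi_pos])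

theorem sin_sq_pi_div_five : Real.sin (Real.pi / 5) ^ 2 = (3 - Real.goldenRatio) / 4 := by
  rw [Real.sin_sq, cos_pi_div_five_eq]
  linear_combination -(1 / 4 : ℝ) * Real.goldenRatio_sq

/-! ### The pentagon in coordinates along and across a direction -/

/-- The abscissas of the vertices of `P`, divided by `sin (π / 5)`. -/
def abscissa : Fin 5 → ℝ := ![0, -Real.goldenRatio, -1, 1, Real.goldenRatio]

/-- The ordinates of the vertices of `P`. -/
def ordinate : Fin 5 → ℝ :=
  ![1, (Real.goldenRatio - 1) / 2, -Real.goldenRatio / 2, -Real.goldenRatio / 2,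
    (Real.goldenRatio - 1) / 2]

theorem vertex_eq (j : Fin 5) : vertex j =
    ⟨-Real.sin (2 * Real.pi * (j : ℕ) / 5), Real.cos (2 * Real.pi * (j : ℕ) / 5)⟩ := by
  have e : (2 * Real.pi * Complex.I * (j : ℕ) / 5 : ℂ) =
      ((2 * Real.pi * (j : ℕ) / 5 : ℝ) : ℂ) * Complex.I := by
    push_cast
    ring
  rw [vertex, e, Complex.exp_mul_I]
  apply Complex.ext <;> simp [← Complex.ofReal_cos, ← Complex.ofReal_sin, -Complex.ofReal_div,
    -Complex.ofReal_mul]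

theorem vertex_re_im (j : Fin 5) : (vertex j).re = abscissa j * Real.sin (Real.pi / 5) ∧
    (vertex j).im = ordinate j := by
  have s1 : Real.sin (2 * (Real.pi / 5)) = Real.goldenRatio * Real.sin (Real.pi / 5) := by
    rw [Real.sin_two_mul, cos_pi_div_five_eq]
    ring
  have c1 : Real.cos (2 * (Real.pi / 5)) = (Real.goldenRatio - 1) / 2 := by
    rw [Real.cos_two_mul, cos_pi_div_five_eq]
    linear_combination (1 / 2 : ℝ) * Real.goldenRatio_sq
  have c0 := cos_pi_div_five_eq
  rw [vertex_eq]
  fin_cases j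
  · simp [abscissa, ordinate]
  · have e : 2 * Real.pi * ((1 : ℕ) : ℝ) / 5 = 2 * (Real.pi / 5) := by push_cast; ring
    simp only [abscissa, ordinate, e, s1, c1]
    simp
  · have e : 2 * Real.pi * ((2 : ℕ) : ℝ) / 5 = Real.pi - Real.pi / 5 := by push_cast; ring
    simp only [abscissa, ordinate, e, Real.sin_pi_sub, Real.cos_pi_sub, c0]
    simp [neg_div]
  · have e : 2 * Real.pi * ((3 : ℕ) : ℝ) / 5 = Real.pi / 5 + Real.pi := by push_cast; ring
    simp only [abscissa, ordinate, e, Real.sin_add_pi, Real.cos_add_pi, c0]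
    simp [neg_div]
  · have e : 2 * Real.pi * ((4 : ℕ) : ℝ) / 5 = 2 * Real.pi - 2 * (Real.pi / 5) := by
      push_cast; ring
    simp only [abscissa, ordinate, e, Real.sin_two_pi_sub, Real.cos_two_pi_sub, c1, s1]
    simp

/-- The coordinate transverse to the direction `x`. -/
def transverse (x : ℝ) (z : ℂ) : ℝ := z.re * Real.sin (Real.pi / 5) - z.im * x

/-- The transverse coordinates of the vertices of `P`, measured from the vertex `1`. -/
def vertexPos (s t : ℝ) : Fin 5 → ℝ :=
  ![Real.goldenRatio * s + t, 0, t, t + Real.goldenRatio * s + Real.goldenRatio * t,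
    t + Real.goldenRatio * s + Real.goldenRatio * t + s]

/-- The parameter `s` of the direction `x`. -/
def parS (x : ℝ) : ℝ := (Real.goldenRatio - 1 / 2) * (1 - Real.goldenRatio / 2 - x)

/-- The parameter `t` of the direction `x`. -/
def parT (x : ℝ) : ℝ := (Real.goldenRatio - 1 / 2) * (1 - Real.goldenRatio / 2 + x)

/-- The position of a point with respect to the vertex `1`, across the direction `x`. -/
def pos (x : ℝ) (z : ℂ) : ℝ := transverse x z - transverse x (vertex 1)

theorem pos_vertex (x : ℝ) (j : Fin 5) : pos x (vertex j) = vertexPos (parS x) (parT x) j := by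
  have h := sin_sq_pi_div_five
  have h2 := Real.goldenRatio_sq
  rw [pos, transverse, transverse, (vertex_re_im j).1, (vertex_re_im j).2, (vertex_re_im 1).1,
    (vertex_re_im 1).2]
  -- After these multiplications by `φ`, `x` and `φ x`, the claim is linear in the monomials.
  have k1 := congrArg (· * Real.goldenRatio) h2
  have k2 := congrArg (· * x) h2
  have k3 := congrArg (· * x) k1
  have k4 := congrArg (· * Real.goldenRatio) h
  beta_reduce at k1 k2 k3 k4
  fin_cases j <;> simp [abscissa, ordinate, vertexPos, parS, parT] <;> linarith

theorem smul_direction_re_im (x t : ℝ) :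
    ((t : ℂ) * direction x).re = t * x ∧
      ((t : ℂ) * direction x).im = t * Real.sin (Real.pi / 5) := by
  have h : direction x = ⟨x, Real.sin (Real.pi / 5)⟩ := by
    rw [direction, ← Complex.mk_eq_add_mul_I]
  rw [h]
  simp

theorem pos_add_smul_direction (x : ℝ) (z : ℂ) (t : ℝ) :
    pos x (z + (t : ℂ) * direction x) = pos x z := by
  simp only [pos, transverse, Complex.add_re, Complex.add_im, (smul_direction_re_im x t).1,
    (smul_direction_re_im x t).2]
  ring

theorem eq_smul_direction {x : ℝ} {z : ℂ} (hz : transverse x z = 0) :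
    ∃ t : ℝ, z = (t : ℂ) * direction x := by
  have h := sin_pi_div_five_pos
  rw [transverse] at hz
  refine ⟨z.im / Real.sin (Real.pi / 5), ?_⟩
  apply Complex.ext
  · rw [(smul_direction_re_im x _).1]
    field_simp
    linarith
  · rw [(smul_direction_re_im x _).2]
    field_simp

theorem vertexPos_sub_eq (x : ℝ) (j : Fin 5) :
    vertexPos (parS x) (parT x) (j + 1) - vertexPos (parS x) (parT x) j =
      transverse x (vertex (j + 1) - vertex j) := by
  rw [← pos_vertex, ← pos_vertex]
  simp [pos, transverse]
  ring

/-- The position of `z` with respect to the side `j`: positive in the interior of `P`. -/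
def height (j : Fin 5) (z : ℂ) : ℝ :=
  (vertex (j + 1) - vertex j).re * (z - vertex j).im -
    (vertex (j + 1) - vertex j).im * (z - vertex j).re

theorem height_vertex_pos {j k : Fin 5} (h1 : k ≠ j) (h2 : k ≠ j + 1) : 0 < height j (vertex k) := by
  have hs := sin_pi_div_five_pos
  obtain ⟨b1, b2⟩ := goldenRatio_bounds
  have hφ := Real.goldenRatio_sq
  suffices H : 0 < (abscissa (j + 1) - abscissa j) * (ordinate k - ordinate j) -
      (ordinate (j + 1) - ordinate j) * (abscissa k - abscissa j) by
    have := mul_pos H hs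
    simp only [height, Complex.sub_re, Complex.sub_im, (vertex_re_im _).1, (vertex_re_im _).2]
    linarith
  simp only [abscissa, ordinate]
  generalize Real.goldenRatio = φ at *
  fin_cases j <;> fin_cases k <;> first
    | exact absurd rfl h1
    | exact absurd rfl h2
    | (simp; nlinarith)

theorem height_vertex_nonneg (j k : Fin 5) : 0 ≤ height j (vertex k) := by
  by_cases h1 : k = j
  · simp [h1, height]
  by_cases h2 : k = j + 1
  · rw [h2, height, mul_comm, sub_self]
  · exact (height_vertex_pos h1 h2).le

theorem height_combo (j : Fin 5) (z z' : ℂ) {a b : ℝ} (hab : a + b = 1) :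
    height j (a • z + b • z') = a * height j z + b * height j z' := by
  obtain rfl : b = 1 - a := by linarith
  simp [height]
  ring

theorem height_self {j : Fin 5} {p : ℂ} (hp : p ∈ openSegment ℝ (vertex j) (vertex (j + 1))) :
    height j p = 0 := by
  obtain ⟨a, b, ha, hb, hab, rfl⟩ := hp
  rw [height_combo j _ _ hab]
  simp [height, mul_comm]

theorem height_pos {i j : Fin 5} (hij : i ≠ j) {p : ℂ}
    (hp : p ∈ openSegment ℝ (vertex i) (vertex (i + 1))) : 0 < height j p := by
  obtain ⟨a, b, ha, hb, hab, rfl⟩ := hp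
  rw [height_combo j _ _ hab]
  by_cases h : i = j + 1
  · have : 0 < height j (vertex (i + 1)) := by
      apply height_vertex_pos <;> subst h
      · revert j; decide
      · revert j; decide
    have := mul_pos hb this
    have := mul_nonneg ha.le (height_vertex_nonneg j i)
    linarith
  · have := mul_pos ha (height_vertex_pos hij h)
    have := mul_nonneg hb.le (height_vertex_nonneg j (i + 1))
    linarith

theorem height_add_smul_direction (x t : ℝ) (j : Fin 5) (p : ℂ) :
    height j (p + (t : ℂ) * direction x) = height j p +
      t * (vertexPos (parS x) (parT x) (j + 1) - vertexPos (parS x) (parT x) j) := by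
  rw [vertexPos_sub_eq]
  simp only [height, transverse, Complex.add_re, Complex.add_im, Complex.sub_re, Complex.sub_im,
    (smul_direction_re_im x t).1, (smul_direction_re_im x t).2]
  ring

/-- A segment inside `P` that joins the sides `i` and `j` goes from the left to the right of the
line of either side. -/
theorem transit {x t : ℝ} {i j : Fin 5} (hij : i ≠ j) {p p' : ℂ}
    (hp : p ∈ openSegment ℝ (vertex i) (vertex (i + 1)))
    (hp' : p' ∈ openSegment ℝ (vertex j) (vertex (j + 1)))
    (h : p' = p + (t : ℂ) * direction x) :
    0 < t * (vertexPos (parS x) (parT x) (i + 1) - vertexPos (parS x) (parT x) i) ∧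
    0 < t * (vertexPos (parS x) (parT x) j - vertexPos (parS x) (parT x) (j + 1)) := by
  have h1 := height_pos hij hp
  have h2 := height_pos hij.symm hp'
  have h3 := height_self hp
  have h4 := height_self hp'
  rw [h, height_add_smul_direction] at h2 h4
  constructor <;> linarith

/-- Central symmetry takes the point `p - sideShift j` of `Q` to this point of `P`. Thus a segment
in `Q` becomes a segment in `P` with its ends exchanged, to which `transit` applies. -/
theorem sub_mem_side {j : Fin 5} {p : ℂ} (hp : p ∈ openSegment ℝ (vertex j) (vertex (j + 1))) :
    sideShift j - p ∈ openSegment ℝ (vertex j) (vertex (j + 1)) := by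
  obtain ⟨a, b, ha, hb, hab, rfl⟩ := hp
  refine ⟨b, a, hb, ha, by linarith, ?_⟩
  obtain rfl : b = 1 - a := by linarith
  simp only [sideShift, Complex.real_smul]
  push_cast
  ring

theorem pos_side {x : ℝ} {j : Fin 5} {p : ℂ}
    (hp : p ∈ openSegment ℝ (vertex j) (vertex (j + 1))) :
    pos x p ∈ openSegment ℝ (vertexPos (parS x) (parT x) j) (vertexPos (parS x) (parT x) (j + 1)) := by
  obtain ⟨a, b, ha, hb, hab, rfl⟩ := hp
  refine ⟨a, b, ha, hb, hab, ?_⟩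
  rw [← pos_vertex, ← pos_vertex]
  obtain rfl : b = 1 - a := by linarith
  simp [pos, transverse]
  ring

theorem pos_sub_sideShift (x : ℝ) (j : Fin 5) (p : ℂ) :
    pos x (p - sideShift j) = pos x p -
      (vertexPos (parS x) (parT x) j + vertexPos (parS x) (parT x) (j + 1)) -
        2 * transverse x (vertex 1) := by
  rw [← pos_vertex, ← pos_vertex]
  simp [pos, transverse, sideShift]
  ring

/-- The point of the side `j` at the position `y`. -/
def sidePoint (x : ℝ) (j : Fin 5) (y : ℝ) : ℂ :=
  AffineMap.lineMap (vertex j) (vertex (j + 1))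
    ((y - vertexPos (parS x) (parT x) j) /
      (vertexPos (parS x) (parT x) (j + 1) - vertexPos (parS x) (parT x) j))

theorem sidePoint_spec {x y : ℝ} {j : Fin 5}
    (h : (vertexPos (parS x) (parT x) j < y ∧ y < vertexPos (parS x) (parT x) (j + 1)) ∨
      (vertexPos (parS x) (parT x) (j + 1) < y ∧ y < vertexPos (parS x) (parT x) j)) :
    sidePoint x j y ∈ openSegment ℝ (vertex j) (vertex (j + 1)) ∧ pos x (sidePoint x j y) = y := by
  have e := vertexPos_sub_eq x j
  have e0 := pos_vertex x j
  have hne : vertexPos (parS x) (parT x) (j + 1) - vertexPos (parS x) (parT x) j ≠ 0 := by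
    rcases h with h | h <;> intro h0 <;> linarith
  constructor
  · rw [sidePoint, openSegment_eq_image_lineMap]
    refine Set.mem_image_of_mem _ ?_
    rcases h with ⟨h1, h2⟩ | ⟨h1, h2⟩
    · exact ⟨div_pos (by linarith) (by linarith), (div_lt_one (by linarith)).2 (by linarith)⟩
    · exact ⟨div_pos_of_neg_of_neg (by linarith) (by linarith),
        (div_lt_one_of_neg (by linarith)).2 (by linarith)⟩
  · have : ∀ θ : ℝ, pos x (AffineMap.lineMap (vertex j) (vertex (j + 1)) θ) = pos x (vertex j) +
        θ * transverse x (vertex (j + 1) - vertex j) := by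
      intro θ
      simp [AffineMap.lineMap_apply, pos, transverse]
      ring
    rw [sidePoint, this, ← e, e0, div_mul_cancel₀ _ hne]
    ring

/-- The pair of sides that labels an interval. -/
def Letter.sides : Letter → Fin 5 × Fin 5
  | .a => (0, 2)
  | .b => (0, 1)
  | .c => (4, 3)
  | .d => (4, 2)

theorem Letter.sides_injective : Function.Injective Letter.sides := by
  intro x y h
  cases x <;> cases y <;> simp_all [Letter.sides]

theorem eq_of_vertexPos_lt {s t : ℝ} (hs : 0 ≤ s) (ht : 0 ≤ t) {j : Fin 5}
    (h : vertexPos s t j < vertexPos s t (j + 1)) : j = 1 ∨ j = 2 ∨ j = 3 := by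
  have h1 := mul_nonneg Real.goldenRatio_pos.le hs
  have h2 := mul_nonneg Real.goldenRatio_pos.le ht
  fin_cases j
  · simp [vertexPos] at h
    linarith
  · exact Or.inl rfl
  · exact Or.inr (Or.inl rfl)
  · exact Or.inr (Or.inr rfl)
  · simp [vertexPos] at h
    linarith

theorem eq_of_lt_vertexPos {s t : ℝ} (hs : 0 ≤ s) (ht : 0 ≤ t) {j : Fin 5}
    (h : vertexPos s t (j + 1) < vertexPos s t j) : j = 0 ∨ j = 4 := by
  have h1 := mul_nonneg Real.goldenRatio_pos.le hs
  have h2 := mul_nonneg Real.goldenRatio_pos.le ht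
  fin_cases j
  · exact Or.inl rfl
  · simp [vertexPos] at h
    linarith
  · simp [vertexPos] at h
    linarith
  · simp [vertexPos] at h
    linarith
  · exact Or.inr rfl

/-- In a direction with nonnegative parameters a trajectory leaves `P` through the sides `0`, `4`
and enters it through the sides `1`, `2`, `3`. -/
theorem IsTrajectory.sides {x : ℝ} (hs : 0 ≤ parS x) (ht : 0 ≤ parT x) {s : ℤ → Fin 5}
    {p : ℤ → ℂ} (h : IsTrajectory (direction x) s p) (n : ℤ) :
    (Even n → s n = 0 ∨ s n = 4) ∧ (Odd n → s n = 1 ∨ s n = 2 ∨ s n = 3) := by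
  constructor
  · intro hn
    obtain ⟨t, ht0, e⟩ := h.segment_Q n hn
    have := (transit (x := x) (t := t) (h.side_ne n) (sub_mem_side (h.mem_side (n + 1)))
      (sub_mem_side (h.mem_side n)) (by linear_combination e)).2
    exact eq_of_lt_vertexPos hs ht (by linarith [(mul_pos_iff_of_pos_left ht0).1 this])
  · intro hn
    obtain ⟨t, ht0, e⟩ := h.segment_P n hn
    have := (transit (x := x) (t := t) (h.side_ne n).symm (h.mem_side n) (h.mem_side (n + 1)) e).1
    exact eq_of_vertexPos_lt hs ht (by linarith [(mul_pos_iff_of_pos_left ht0).1 this])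

theorem mem_openSegment_bounds {a b y : ℝ} (h : y ∈ openSegment ℝ a b) :
    (a < b → a < y ∧ y < b) ∧ (b < a → b < y ∧ y < a) := by
  refine ⟨fun g => ?_, fun g => ?_⟩
  · rwa [openSegment_eq_Ioo g] at h
  · rw [openSegment_symm, openSegment_eq_Ioo g] at h
    exact h

/-- The position across the direction is constant along segments and changes only by the gluing
translations of the two sides crossed. Of the six exit-entrance pairs, `(0, 3)` and `(4, 1)` are
impossible by position; the other four are the letters. -/
theorem exists_letter {x : ℝ} (hs : 0 ≤ parS x) (ht : 0 ≤ parT x) {s : ℤ → Fin 5}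
    {p : ℤ → ℂ} (h : IsTrajectory (direction x) s p) (n : ℤ) :
    ∃ y : Letter, (s (2 * n), s (2 * n + 1)) = y.sides ∧
      ((Lengths.ofPair (parS x) (parT x)).lo y < pos x (p (2 * n)) ∧
        pos x (p (2 * n)) < (Lengths.ofPair (parS x) (parT x)).hi y) ∧
      pos x (p (2 * (n + 1))) = pos x (p (2 * n)) + (Lengths.ofPair (parS x) (parT x)).sh y := by
  have he : Even (2 * n) := even_two_mul n
  have ho : Odd (2 * n + 1) := he.add_one
  have q1 := (h.sides hs ht (2 * n)).1 he
  have q2 := (h.sides hs ht (2 * n + 1)).2 ho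
  obtain ⟨t, t0, e⟩ := h.segment_Q _ he
  obtain ⟨t', t0', e'⟩ := h.segment_P _ ho
  have m1 := mem_openSegment_bounds (pos_side (x := x) (h.mem_side (2 * n)))
  have m2 := mem_openSegment_bounds (pos_side (x := x) (h.mem_side (2 * n + 1)))
  have f := congrArg (pos x) e
  rw [pos_add_smul_direction, pos_sub_sideShift, pos_sub_sideShift] at f
  have f' := congrArg (pos x) e'
  rw [pos_add_smul_direction, show 2 * n + 1 + 1 = 2 * (n + 1) by ring] at f'
  have g := (transit (x := x) (t := t) (h.side_ne _) (sub_mem_side (h.mem_side (2 * n + 1)))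
      (sub_mem_side (h.mem_side (2 * n))) (by linear_combination e))
  rw [mul_pos_iff_of_pos_left t0, mul_pos_iff_of_pos_left t0] at g
  obtain ⟨g1, g2⟩ := g
  have r1 := m1.2 (by linarith)
  have r2 := m2.1 (by linarith)
  clear m1 m2 e e'
  have h1 := mul_nonneg Real.goldenRatio_pos.le hs
  have h2 := mul_nonneg Real.goldenRatio_pos.le ht
  rw [f']
  generalize pos x (p (2 * n + 1)) = y' at *
  generalize pos x (p (2 * n)) = y at *
  clear f'
  rcases q1 with q1 | q1 <;> rcases q2 with q2 | q2 | q2 <;>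
    simp only [q1, q2] at r1 r2 f g1 g2 ⊢ <;> simp [vertexPos] at r1 r2 f g1 g2
  · refine ⟨.b, rfl, ?_⟩
    simp only [Lengths.lo, Lengths.hi, Lengths.sh, Lengths.ofPair]
    and_intros <;> linarith
  · refine ⟨.a, rfl, ?_⟩
    simp only [Lengths.lo, Lengths.hi, Lengths.sh, Lengths.ofPair]
    and_intros <;> linarith
  · exfalso
    linarith
  · exfalso
    linarith
  · refine ⟨.d, rfl, ?_⟩
    simp only [Lengths.lo, Lengths.hi, Lengths.sh, Lengths.ofPair]
    and_intros <;> linarith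
  · refine ⟨.c, rfl, ?_⟩
    simp only [Lengths.lo, Lengths.hi, Lengths.sh, Lengths.ofPair]
    and_intros <;> linarith

theorem cell_sides {s t : ℝ} (hs : 0 ≤ s) (ht : 0 ≤ t) {y : Letter} {u : ℝ}
    (hu : (Lengths.ofPair s t).lo y < u ∧ u < (Lengths.ofPair s t).hi y) :
    (vertexPos s t (y.sides.1 + 1) < u ∧ u < vertexPos s t y.sides.1) ∧
    (vertexPos s t y.sides.2 < u + (Lengths.ofPair s t).sh y ∧
      u + (Lengths.ofPair s t).sh y < vertexPos s t (y.sides.2 + 1)) ∧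
    u + (Lengths.ofPair s t).sh y = u -
      (vertexPos s t y.sides.1 + vertexPos s t (y.sides.1 + 1)) +
      (vertexPos s t y.sides.2 + vertexPos s t (y.sides.2 + 1)) := by
  have h1 := mul_nonneg Real.goldenRatio_pos.le hs
  have h2 := mul_nonneg Real.goldenRatio_pos.le ht
  obtain ⟨u1, u2⟩ := hu
  cases y <;> simp only [Lengths.lo, Lengths.hi, Lengths.sh, Lengths.ofPair] at u1 u2 ⊢ <;>
    simp [vertexPos, Letter.sides] <;> and_intros <;> linarith

theorem sides_fst_ne_snd (y y' : Letter) : y.sides.1 ≠ y'.sides.2 := by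
  cases y <;> cases y' <;> decide

/-- Conversely, an orbit of the exchange is realized by placing crossing points on the prescribed
sides at the prescribed positions. Points with equal positions differ by a multiple of the
direction, and `transit` shows that the multiple is positive. -/
theorem intervalWords_eq {x : ℝ} (hs : 0 ≤ parS x) (ht : 0 ≤ parT x) :
    intervalWords x =
      (fun w n => Letter.sides (w n)) '' (Lengths.ofPair (parS x) (parT x)).words := by
  ext w
  constructor
  · rintro ⟨s, ⟨p, hp⟩, hw⟩
    choose y hy using exists_letter hs ht hp
    refine ⟨y, ⟨fun n => pos x (p (2 * n)), fun n => (hy n).2⟩, ?_⟩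
    funext n
    rw [hw, (hy n).1]
  · rintro ⟨y, ⟨u, hu⟩, rfl⟩
    have hc := fun n => cell_sides hs ht (hu n).1
    have hsucc : ∀ n, u n + (Lengths.ofPair (parS x) (parT x)).sh (y n) = u (n + 1) :=
      fun n => ((hu n).2).symm
    simp only [hsucc] at hc
    let s : ℤ → Fin 5 := fun n => if Even n then (y (n / 2)).sides.1 else (y (n / 2)).sides.2
    let p : ℤ → ℂ := fun n => if Even n then sidePoint x (y (n / 2)).sides.1 (u (n / 2))
      else sidePoint x (y (n / 2)).sides.2 (u (n / 2 + 1))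
    have se : ∀ k, s (2 * k) = (y k).sides.1 := by
      intro k
      simp [s]
    have so : ∀ k, s (2 * k + 1) = (y k).sides.2 := by
      intro k
      simp [s, show (2 * k + 1) / 2 = k by omega]
    have pe : ∀ k, p (2 * k) = sidePoint x (y k).sides.1 (u k) := by
      intro k
      simp [p]
    have po : ∀ k, p (2 * k + 1) = sidePoint x (y k).sides.2 (u (k + 1)) := by
      intro k
      simp [p, show (2 * k + 1) / 2 = k by omega]
    have d1 := fun k => sidePoint_spec (Or.inr (hc k).1)
    have d2 := fun k => sidePoint_spec (Or.inl (hc k).2.1)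
    refine ⟨s, ⟨p, ?_, ?_, ?_, ?_⟩, ?_⟩
    · intro n
      obtain ⟨k, rfl | rfl⟩ := Int.even_or_odd' n
      · rw [pe, se]
        exact (d1 k).1
      · rw [po, so]
        exact (d2 k).1
    · intro n
      obtain ⟨k, rfl | rfl⟩ := Int.even_or_odd' n
      · rw [so, se]
        exact (sides_fst_ne_snd _ _).symm
      · rw [so, show 2 * k + 1 + 1 = 2 * (k + 1) by ring, se]
        exact sides_fst_ne_snd _ _
    · intro n hn
      obtain ⟨k, rfl⟩ := hn.exists_two_nsmul
      rw [two_nsmul, ← two_mul, po, so, pe, se]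
      have hz : transverse x (sidePoint x (y k).sides.2 (u (k + 1)) - sideShift (y k).sides.2 -
          (sidePoint x (y k).sides.1 (u k) - sideShift (y k).sides.1)) = 0 := by
        have f1 := pos_sub_sideShift x (y k).sides.2 (sidePoint x (y k).sides.2 (u (k + 1)))
        have f2 := pos_sub_sideShift x (y k).sides.1 (sidePoint x (y k).sides.1 (u k))
        rw [(d2 k).2] at f1
        rw [(d1 k).2] at f2
        have e := (hc k).2.2
        simp only [pos, transverse, Complex.sub_re, Complex.sub_im] at f1 f2 ⊢
        linarith
      obtain ⟨t, ht'⟩ := eq_smul_direction hz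
      refine ⟨t, ?_, by linear_combination ht'⟩
      have := (transit (x := x) (t := t) (sides_fst_ne_snd (y k) (y k)).symm (sub_mem_side (d2 k).1)
        (sub_mem_side (d1 k).1) (by linear_combination ht')).2
      exact (pos_iff_pos_of_mul_pos this).2 (by linarith [(hc k).1])
    · intro n hn
      obtain ⟨k, rfl⟩ := hn
      rw [po, show 2 * k + 1 + 1 = 2 * (k + 1) by ring, pe]
      have hz : transverse x (sidePoint x (y (k + 1)).sides.1 (u (k + 1)) -
          sidePoint x (y k).sides.2 (u (k + 1))) = 0 := by
        have f1 := (d2 k).2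
        have f2 := (d1 (k + 1)).2
        simp only [pos, transverse, Complex.sub_re, Complex.sub_im] at f1 f2 ⊢
        linarith
      obtain ⟨t, ht'⟩ := eq_smul_direction hz
      refine ⟨t, ?_, by linear_combination ht'⟩
      have := (transit (x := x) (t := t) (sides_fst_ne_snd (y (k + 1)) (y k)).symm (d2 k).1
        (d1 (k + 1)).1 (by linear_combination ht')).1
      exact (pos_iff_pos_of_mul_pos this).2 (by linarith [(hc k).2.1])
    · intro n
      rw [se, so]

/-- The periods of the words of sides are twice those of the words of intervals. -/
theorem sideWords_isPeriodPair {x : ℝ} (hs : 0 ≤ parS x) (ht : 0 ≤ parT x) {a A : ℕ}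
    (h : IsPeriodPair (intervalWords x) a A) : IsPeriodPair (sideWords x) (2 * a) (2 * A) := by
  have par : ∀ s ∈ sideWords x, ∀ n, (Even n → s n = 0 ∨ s n = 4) ∧
      (Odd n → s n = 1 ∨ s n = 2 ∨ s n = 3) := by
    rintro s ⟨p, hp⟩ n
    exact hp.sides hs ht n
  -- Exits through `0, 4` stand at even places and entrances through `1, 2, 3` at odd ones, so a
  -- shift between side words is even.
  have even : ∀ s ∈ sideWords x, ∀ s' ∈ sideWords x, ∀ m : ℤ, (∀ n, s' n = s (n + m)) →
      Even m := by
    intro s hs' s' hs'' m hm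
    by_contra ho
    rw [Int.not_even_iff_odd] at ho
    have e1 := (par s hs' m).2 ho
    have e2 := (par s' hs'' 0).1 Even.zero
    rw [hm, zero_add] at e2
    revert e1 e2
    generalize s m = j
    revert j
    decide
  have period : ∀ s ∈ sideWords x, ∀ q : ℕ,
      HasPeriod (fun n => (s (2 * n), s (2 * n + 1))) q → HasPeriod s (2 * q) := by
    intro s hs' q hq
    constructor
    · refine ⟨Nat.mul_pos two_pos hq.1.1, fun n => ?_⟩
      obtain ⟨k, rfl | rfl⟩ := Int.even_or_odd' n
      · have := congrArg Prod.fst (hq.1.2 k)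
        simp only at this
        rw [← this]
        congr 1
        push_cast
        ring
      · have := congrArg Prod.snd (hq.1.2 k)
        simp only at this
        rw [← this]
        congr 1
        push_cast
        ring
    · rintro r ⟨hr0, hr⟩
      obtain ⟨k, hk⟩ := even s hs' s hs' r (fun n => (hr n).symm)
      have hk' : k = (k.toNat : ℤ) := by omega
      have := hq.2 (show k.toNat ∈ _ from ⟨by omega, fun n => by
        rw [← hk']
        have e1 := hr (2 * n)
        have e2 := hr (2 * n + 1)
        rw [hk] at e1 e2
        show (s (2 * (n + k)), s (2 * (n + k) + 1)) = (s (2 * n), s (2 * n + 1))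
        rw [← e1, ← e2]
        congr 2 <;> ring⟩)
      omega
  obtain ⟨hle, w, ⟨s, hsw, hw⟩, w', ⟨s', hsw', hw'⟩, h1, h2, h3, h4⟩ := h
  obtain rfl : w = fun n => (s (2 * n), s (2 * n + 1)) := funext hw
  obtain rfl : w' = fun n => (s' (2 * n), s' (2 * n + 1)) := funext hw'
  refine ⟨by omega, s, hsw, s', hsw', period s hsw a h1, period s' hsw' A h2, ?_, ?_⟩
  · rintro ⟨m, hm⟩
    obtain ⟨k, rfl⟩ := even s hsw s' hsw' m hm
    refine h3 ⟨k, fun n => ?_⟩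
    simp only [hm]
    congr 2 <;> ring
  · have lift : ∀ s₁ s₂ : ℤ → Fin 5, SameOrbit (fun n => (s₁ (2 * n), s₁ (2 * n + 1)))
        (fun n => (s₂ (2 * n), s₂ (2 * n + 1))) → SameOrbit s₁ s₂ := by
      rintro s₁ s₂ ⟨m, hm⟩
      refine ⟨2 * m, fun n => ?_⟩
      obtain ⟨k, rfl | rfl⟩ := Int.even_or_odd' n
      · have := congrArg Prod.fst (hm k)
        simp only at this
        rw [this]
        congr 1
        ring
      · have := congrArg Prod.snd (hm k)
        simp only at this
        rw [this]
        congr 1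
        ring
    intro u hu
    exact (h4 _ ⟨u, hu, fun n => rfl⟩).imp (lift _ _) (lift _ _)

open OnePoint

/-! ### The tiling in linear coordinates -/

/-- The point of the projective line with homogeneous coordinates `(X, Y)`. -/
def homog (X Y : ℝ) : OnePoint ℝ := if Y = 0 then ∞ else ((X / Y : ℝ) : OnePoint ℝ)

theorem smul_homog (g : GL (Fin 2) ℝ) {X Y : ℝ} (h : X ≠ 0 ∨ Y ≠ 0) :
    g • homog X Y = homog (g 0 0 * X + g 0 1 * Y) (g 1 0 * X + g 1 1 * Y) := by
  by_cases hY : Y = 0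
  · have hX : X ≠ 0 := h.resolve_right (not_not.2 hY)
    simp only [homog, hY, if_true, smul_infty_eq_ite, mul_zero, add_zero, mul_eq_zero, hX, or_false]
    split_ifs with h1
    · rfl
    · rw [mul_div_mul_right _ _ hX]
  · have e : g 1 0 * (X / Y) + g 1 1 = (g 1 0 * X + g 1 1 * Y) / Y := by field_simp
    simp only [homog, hY, if_false, smul_some_eq_ite, e, div_eq_zero_iff, or_false]
    split_ifs with h1
    · rfl
    · congr 1
      field_simp

theorem homog_mul {c X Y : ℝ} (hc : c ≠ 0) : homog (c * X) (c * Y) = homog X Y := by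
  simp only [homog, mul_eq_zero, hc, false_or, mul_div_mul_left _ _ hc]

/-- The abscissa `1 - φ / 2` of the right end of the side of the ideal pentagon. -/
def corner : ℝ := 1 - Real.goldenRatio / 2

theorem corner_pos : 0 < corner := by
  have := goldenRatio_bounds.2
  rw [corner]
  linarith

/-- The direction with linear coordinates `v` in the basis of the directions `φ / 2 - 1`
and `1 - φ / 2`. -/
def proj (v : ℝ × ℝ) : OnePoint ℝ := homog (corner * (v.2 - v.1)) (v.1 + v.2)

/-- The linear rotation that induces `T`. -/
def rot (v : ℝ × ℝ) : ℝ × ℝ := (-v.2, v.1 + Real.goldenRatio * v.2)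

/-- The linear reflection that induces `R`. -/
def refl (v : ℝ × ℝ) : ℝ × ℝ := (v.1, -v.2)

theorem homog_ne {v : ℝ × ℝ} (hv : v ≠ 0) : corner * (v.2 - v.1) ≠ 0 ∨ v.1 + v.2 ≠ 0 := by
  by_contra! h
  obtain ⟨h1, h2⟩ := h
  have h3 := (mul_eq_zero.1 h1).resolve_left corner_pos.ne'
  exact hv (Prod.ext (by simp; linarith) (by simp; linarith))

/-- In these coordinates the matrix of `T` is `4` times that of `rot`; the factor disappears
projectively. For `R` and `refl` the factor is `-2 φ ^ 2`. -/
theorem rotT_smul_proj {v : ℝ × ℝ} (hv : v ≠ 0) : rotT • proj v = proj (rot v) := by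
  have h := Real.goldenRatio_sq
  have e00 : rotT 0 0 = 2 * Real.goldenRatio := rfl
  have e01 : rotT 0 1 = 3 - Real.goldenRatio := rfl
  have e10 : rotT 1 0 = -4 := rfl
  have e11 : rotT 1 1 = 2 * Real.goldenRatio := rfl
  rw [proj, smul_homog _ (homog_ne hv), proj, e00, e01, e10, e11]
  refine Eq.trans ?_ (homog_mul (c := 4) (by norm_num))
  congr 1
  · simp only [rot, corner]
    linear_combination (v.1 + v.2) * h
  · simp only [rot, corner]
    ring

theorem two_mul_sq_mul_corner : 2 * Real.goldenRatio ^ 2 * corner = 1 := by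
  have h := Real.goldenRatio_sq
  rw [corner]
  linear_combination (-Real.goldenRatio + 1) * h

theorem reflR_smul_proj {v : ℝ × ℝ} (hv : v ≠ 0) : reflR • proj v = proj (refl v) := by
  have h := two_mul_sq_mul_corner
  have e00 : reflR 0 0 = 0 := rfl
  have e01 : reflR 0 1 = 1 := rfl
  have e10 : reflR 1 0 = 4 * Real.goldenRatio ^ 4 := rfl
  have e11 : reflR 1 1 = 0 := rfl
  have hc : corner * (2 * Real.goldenRatio ^ 2) ^ 2 = 2 * Real.goldenRatio ^ 2 := by
    linear_combination (2 * Real.goldenRatio ^ 2) * h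
  rw [proj, smul_homog _ (homog_ne hv), proj, e00, e01, e10, e11]
  refine Eq.trans ?_ (homog_mul (c := -(2 * Real.goldenRatio ^ 2))
    (neg_ne_zero.2 (mul_pos two_pos (pow_pos Real.goldenRatio_pos 2)).ne'))
  congr 1
  · simp only [refl]
    linear_combination -(v.1 + v.2) * h
  · simp only [refl]
    linear_combination (v.2 - v.1) * hc

theorem proj_smul {c : ℝ} (hc : c ≠ 0) (v : ℝ × ℝ) : proj (c • v) = proj v := by
  rw [proj, proj]
  refine Eq.trans ?_ (homog_mul hc)
  simp only [Prod.smul_fst, Prod.smul_snd, smul_eq_mul]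
  congr 1 <;> ring

theorem proj_neg (v : ℝ × ℝ) : proj (-v) = proj v := by
  rw [← proj_smul (neg_ne_zero.2 one_ne_zero) v, neg_smul, one_smul]

/-- The affine coordinate of the direction with linear coordinates `v`. -/
def coord (v : ℝ × ℝ) : ℝ := corner * (v.2 - v.1) / (v.1 + v.2)

theorem proj_eq_coord {v : ℝ × ℝ} (hv : v.1 + v.2 ≠ 0) : proj v = (coord v : OnePoint ℝ) := by
  rw [proj, homog, if_neg hv, coord]

theorem exists_smul_of_proj_eq {v v' : ℝ × ℝ} (hv : v ≠ 0) (h : proj v' = proj v) :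
    ∃ c : ℝ, v' = c • v := by
  have hc := corner_pos
  by_cases h1 : v.1 + v.2 = 0
  · have h2 : v'.1 + v'.2 = 0 := by
      by_contra h2
      rw [proj_eq_coord h2, proj, homog, if_pos h1] at h
      exact OnePoint.coe_ne_infty _ h
    have h3 : v.1 ≠ 0 := by
      intro h3
      exact hv (Prod.ext h3 (by simp; linarith))
    refine ⟨v'.1 / v.1, Prod.ext ?_ ?_⟩
    · simp [h3]
    · have e1 : v.2 = -v.1 := by linarith
      have e2 : v'.2 = -v'.1 := by linarith
      simp [e1, e2, h3]
  · have h2 : v'.1 + v'.2 ≠ 0 := by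
      intro h2
      rw [proj_eq_coord h1, proj, homog, if_pos h2] at h
      exact OnePoint.infty_ne_coe _ h
    rw [proj_eq_coord h1, proj_eq_coord h2, OnePoint.coe_eq_coe, coord, coord,
      div_eq_div_iff h2 h1, mul_assoc, mul_assoc, mul_right_inj' hc.ne'] at h
    refine ⟨(v'.1 + v'.2) / (v.1 + v.2), Prod.ext ?_ ?_⟩
    · simp only [Prod.smul_fst, smul_eq_mul]
      field_simp
      linarith
    · simp only [Prod.smul_snd, smul_eq_mul]
      field_simp
      linarith

/-! ### Frames: the images of the standard basis -/

theorem rot_neg (v : ℝ × ℝ) : rot (-v) = -rot v := by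
  simp only [rot, Prod.neg_mk, Prod.fst_neg, Prod.snd_neg, Prod.mk.injEq, true_and]
  ring

theorem refl_neg (v : ℝ × ℝ) : refl (-v) = -refl v := by
  simp [refl]

theorem rot_two (v : ℝ × ℝ) : rot (rot v) =
    (-(v.1 + Real.goldenRatio * v.2), Real.goldenRatio * v.1 + Real.goldenRatio * v.2) := by
  have h := Real.goldenRatio_sq
  simp only [rot, Prod.mk.injEq, true_and]
  linear_combination v.2 * h

theorem rot_three (v : ℝ × ℝ) : rot (rot (rot v)) =
    (-(Real.goldenRatio * v.1 + Real.goldenRatio * v.2), Real.goldenRatio * v.1 + v.2) := by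
  have h := Real.goldenRatio_sq
  rw [rot_two v]
  simp only [rot, Prod.mk.injEq, true_and]
  linear_combination (v.1 + v.2) * h

theorem rot_four (v : ℝ × ℝ) :
    rot (rot (rot (rot v))) = (-(Real.goldenRatio * v.1 + v.2), v.1) := by
  have h := Real.goldenRatio_sq
  rw [rot_three v]
  simp only [rot, Prod.mk.injEq, true_and]
  linear_combination v.1 * h

theorem rot_five (v : ℝ × ℝ) : rot (rot (rot (rot (rot v)))) = -v := by
  rw [rot_four v]
  ext <;> simp [rot]

theorem refl_refl (v : ℝ × ℝ) : refl (refl v) = v := by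
  simp [refl]

/-- Pairs `(g e₁, g e₂)` for `g` in the group generated by `rot` and `refl`. -/
inductive Frame : ℝ × ℝ → ℝ × ℝ → Prop
  | base : Frame (1, 0) (0, 1)
  | rot {v u : ℝ × ℝ} : Frame v u → Frame (rot v) (rot u)
  | refl {v u : ℝ × ℝ} : Frame v u → Frame (refl v) (refl u)

namespace Frame

variable {v u : ℝ × ℝ}

theorem det (h : Frame v u) : v.1 * u.2 - v.2 * u.1 = 1 ∨ v.1 * u.2 - v.2 * u.1 = -1 := by
  induction h with
  | base => left; simp
  | rot _ ih =>
    refine ih.imp (fun e => ?_) (fun e => ?_) <;>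
      (rw [← e]; simp only [DoublePentagon.rot]; ring)
  | refl _ ih =>
    refine ih.symm.imp (fun e => ?_) (fun e => ?_) <;> simp only [DoublePentagon.refl] <;> linarith

theorem left_ne (h : Frame v u) : v ≠ 0 := by
  rintro rfl
  simpa using h.det

theorem right_ne (h : Frame v u) : u ≠ 0 := by
  rintro rfl
  simpa using h.det

theorem neg (h : Frame v u) : Frame (-v) (-u) := by
  rw [← rot_five v, ← rot_five u]
  exact h.rot.rot.rot.rot.rot

/-- At the standard basis this is `refl`; linearity carries it to every frame. -/
theorem neg_right (h : Frame v u) : Frame v (-u) := by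
  induction h with
  | base => simpa [DoublePentagon.refl] using Frame.base.refl
  | rot _ ih => simpa only [rot_neg] using ih.rot
  | refl _ ih => simpa only [refl_neg] using ih.refl

theorem _root_.DoublePentagon.rot_add_smul (v u : ℝ × ℝ) (c : ℝ) :
    DoublePentagon.rot (v + c • u) = DoublePentagon.rot v + c • DoublePentagon.rot u := by
  ext <;> simp [DoublePentagon.rot] <;> ring

theorem _root_.DoublePentagon.refl_add_smul (v u : ℝ × ℝ) (c : ℝ) :
    DoublePentagon.refl (v + c • u) = DoublePentagon.refl v + c • DoublePentagon.refl u := by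
  ext <;> (simp [DoublePentagon.refl]; try ring)

/-- This is the next side of the same ideal pentagon: the image of the relation `rot e₂ = -e₁ + φ
e₂`. -/
theorem next (h : Frame v u) : Frame u (-v + Real.goldenRatio • u) := by
  induction h with
  | base => simpa [DoublePentagon.rot] using Frame.base.rot
  | rot _ ih => simpa only [rot_add_smul, rot_neg] using ih.rot
  | refl _ ih => simpa only [refl_add_smul, refl_neg] using ih.refl

theorem prev (h : Frame v u) : Frame (-u + Real.goldenRatio • v) v := by
  induction h with
  | base =>
    have := Frame.base.rot.rot.rot.rot.neg
    rw [rot_four, rot_four] at this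
    simpa using this
  | rot _ ih => simpa only [rot_add_smul, rot_neg] using ih.rot
  | refl _ ih => simpa only [refl_add_smul, refl_neg] using ih.refl

end Frame

/-- The vectors `v` and `u` span a side of an ideal pentagon. -/
def Adj (v u : ℝ × ℝ) : Prop := Frame v u ∨ Frame u v

namespace Adj

variable {v u : ℝ × ℝ}

theorem neg_right (h : Adj v u) : Adj v (-u) :=
  h.imp Frame.neg_right fun g => by simpa using g.neg.neg_right

theorem rot (h : Adj v u) : Adj (rot v) (rot u) := h.imp Frame.rot Frame.rot

theorem refl (h : Adj v u) : Adj (refl v) (refl u) := h.imp Frame.refl Frame.refl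

/-- Up to sign, the new vector is the other neighbour of `v` in an ideal pentagon with the side `v`,
`u`. Replacing `u` by `-u` gives the pentagon across that side, hence the opposite step. -/
theorem sub_smul (h : Adj v u) : Adj v (u + (-Real.goldenRatio) • v) := by
  rcases h with h | h
  · have := h.prev.neg.neg_right
    right
    simpa [add_comm] using this
  · have := h.next.neg_right
    left
    simpa [add_comm] using this

theorem add_smul (h : Adj v u) : Adj v (u + Real.goldenRatio • v) := by
  have := h.neg_right.sub_smul.neg_right
  simpa [add_comm] using this

theorem add_int_smul (h : Adj v u) (k : ℤ) : Adj v (u + (k * Real.goldenRatio) • v) := by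
  induction k using Int.induction_on with
  | zero => simpa using h
  | succ k ih =>
    have := ih.add_smul
    rw [add_assoc, ← _root_.add_smul] at this
    convert this using 3
    push_cast
    ring
  | pred k ih =>
    have := ih.sub_smul
    rw [add_assoc, ← _root_.add_smul] at this
    convert this using 3
    push_cast
    ring

end Adj

/-! ### The tiling group and frames -/

theorem smul_proj_of_mem {g : GL (Fin 2) ℝ} (hg : g ∈ tilingGroup) {v u : ℝ × ℝ}
    (h : Frame v u) : ∃ v' u', Frame v' u' ∧ g • proj v = proj v' ∧ g • proj u = proj u' := by
  revert v u
  induction hg using Subgroup.closure_induction'' with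
  | mem x hx =>
    intro v u h
    rcases hx with rfl | rfl
    · exact ⟨_, _, h.rot, rotT_smul_proj h.left_ne, rotT_smul_proj h.right_ne⟩
    · exact ⟨_, _, h.refl, reflR_smul_proj h.left_ne, reflR_smul_proj h.right_ne⟩
  | inv_mem x hx =>
    intro v u h
    rcases hx with rfl | rfl
    -- The fourth power of `rot` serves as the inverse of `T`, since `rot` to the fifth is `-1`.
    · have h4 := h.rot.rot.rot.rot
      refine ⟨_, _, h4, ?_, ?_⟩
      · rw [inv_smul_eq_iff, rotT_smul_proj h4.left_ne, rot_five, proj_neg]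
      · rw [inv_smul_eq_iff, rotT_smul_proj h4.right_ne, rot_five, proj_neg]
    · refine ⟨_, _, h.refl, ?_, ?_⟩
      · rw [inv_smul_eq_iff, reflR_smul_proj h.refl.left_ne, refl_refl]
      · rw [inv_smul_eq_iff, reflR_smul_proj h.refl.right_ne, refl_refl]
  | one => exact fun h => ⟨_, _, h, one_smul _ _, one_smul _ _⟩
  | mul x y _ _ hx hy =>
    intro v u h
    obtain ⟨v1, u1, h1, e1, e2⟩ := hy h
    obtain ⟨v2, u2, h2, e3, e4⟩ := hx h1
    exact ⟨v2, u2, h2, by rw [mul_smul, e1, e3], by rw [mul_smul, e2, e4]⟩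

theorem Frame.exists_mem {v u : ℝ × ℝ} (h : Frame v u) :
    ∃ g ∈ tilingGroup, proj v = g • proj (1, 0) ∧ proj u = g • proj (0, 1) := by
  induction h with
  | base => exact ⟨1, one_mem _, (one_smul _ _).symm, (one_smul _ _).symm⟩
  | rot h ih =>
    obtain ⟨g, hg, e1, e2⟩ := ih
    refine ⟨rotT * g, mul_mem (Subgroup.subset_closure (Or.inl rfl)) hg, ?_, ?_⟩
    · rw [mul_smul, ← e1, rotT_smul_proj h.left_ne]
    · rw [mul_smul, ← e2, rotT_smul_proj h.right_ne]
  | refl h ih =>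
    obtain ⟨g, hg, e1, e2⟩ := ih
    refine ⟨reflR * g, mul_mem (Subgroup.subset_closure (Or.inr rfl)) hg, ?_, ?_⟩
    · rw [mul_smul, ← e1, reflR_smul_proj h.left_ne]
    · rw [mul_smul, ← e2, reflR_smul_proj h.right_ne]

theorem baseVertex_four : baseVertex 4 = proj (1, 0) := by
  rw [proj_eq_coord (by simp)]
  simp [baseVertex, coord, corner]

theorem baseVertex_zero : baseVertex 0 = proj (0, 1) := by
  rw [proj_eq_coord (by simp)]
  simp [baseVertex, coord, corner]

theorem exists_frame_baseVertex (j : Fin 5) :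
    ∃ v u, Frame v u ∧ baseVertex j = proj v ∧ baseVertex (j + 1) = proj u := by
  have hφ := Real.goldenRatio_sq
  obtain ⟨b1, b2⟩ := goldenRatio_bounds
  have e1 : baseVertex 1 = proj (rot (0, 1)) := by
    have h : rot (0, 1) = (-1, Real.goldenRatio) := by simp [rot]
    have h0 : -1 + Real.goldenRatio ≠ 0 := by linarith
    rw [h, proj_eq_coord h0, coord, corner]
    show ((Real.goldenRatio / 2 : ℝ) : OnePoint ℝ) = _
    congr 1
    rw [eq_div_iff h0]
    linear_combination hφ
  have e2 : baseVertex 2 = proj (rot (rot (0, 1))) := by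
    rw [rot_two, proj, homog, if_pos (by ring)]
    rfl
  have e3 : baseVertex 3 = proj (rot (rot (rot (0, 1)))) := by
    have h0 : -(Real.goldenRatio * 0 + Real.goldenRatio * 1) + (Real.goldenRatio * 0 + 1) ≠ 0 := by
      linarith
    rw [rot_three, proj_eq_coord h0, coord, corner]
    show ((-(Real.goldenRatio / 2) : ℝ) : OnePoint ℝ) = _
    congr 1
    rw [eq_div_iff h0]
    linear_combination hφ
  have hb := Frame.base.rot
  have r1 : rot (1, 0) = (0, 1) := by simp [rot]
  fin_cases j
  · exact ⟨_, _, hb, by rw [r1]; exact baseVertex_zero, e1⟩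
  · exact ⟨_, _, hb.rot, by rw [r1]; exact e1, e2⟩
  · exact ⟨_, _, hb.rot.rot, by rw [r1]; exact e2, e3⟩
  · refine ⟨_, _, hb.rot.rot.rot, by rw [r1]; exact e3, ?_⟩
    rw [rot_four]
    refine baseVertex_four.trans ?_
    rw [← proj_neg]
    simp
  · exact ⟨_, _, Frame.base, baseVertex_four, baseVertex_zero⟩

theorem joinedBySide_iff {x y : OnePoint ℝ} :
    JoinedBySide x y ↔ ∃ v u, Adj v u ∧ x = proj v ∧ y = proj u := by
  constructor
  · rintro ⟨g, hg, j, h⟩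
    obtain ⟨v, u, hf, e1, e2⟩ := exists_frame_baseVertex j
    obtain ⟨v', u', hf', e3, e4⟩ := smul_proj_of_mem hg hf
    rw [e1, e2, e3, e4] at h
    rcases h with ⟨h1, h2⟩ | ⟨h1, h2⟩
    · exact ⟨v', u', Or.inl hf', h1, h2⟩
    · exact ⟨u', v', Or.inr hf', h2, h1⟩
  · rintro ⟨v, u, h | h, rfl, rfl⟩
    · obtain ⟨g, hg, e1, e2⟩ := h.exists_mem
      refine ⟨g, hg, 4, Or.inl ⟨?_, ?_⟩⟩
      · rw [e1, baseVertex_four]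
      · exact e2.trans (congrArg (g • ·) baseVertex_zero.symm)
    · obtain ⟨g, hg, e1, e2⟩ := h.exists_mem
      refine ⟨g, hg, 4, Or.inr ⟨?_, ?_⟩⟩
      · rw [e1, baseVertex_four]
      · exact e2.trans (congrArg (g • ·) baseVertex_zero.symm)

theorem IsTilingVertex.exists_frame {x : OnePoint ℝ} (h : IsTilingVertex x) :
    ∃ v u, Frame v u ∧ x = proj v := by
  obtain ⟨g, hg, j, rfl⟩ := h
  obtain ⟨v, u, hf, e1, e2⟩ := exists_frame_baseVertex j
  obtain ⟨v', u', hf', e3, e4⟩ := smul_proj_of_mem hg hf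
  exact ⟨v', u', hf', by rw [e1, e3]⟩

/-! ### Sides of ideal pentagons inside the interval of directions -/

/-- The images of the standard basis under products of renormalization steps. -/
inductive Cone : ℝ × ℝ → ℝ × ℝ → Prop
  | base : Cone (1, 0) (0, 1)
  | act (m : Move) {a b : ℝ × ℝ} : Cone a b → Cone (m.act a) (m.act b)

namespace Cone

variable {a b : ℝ × ℝ}

theorem good (h : Cone a b) : Lengths.Good a.1 a.2 ∧ Lengths.Good b.1 b.2 := by
  induction h with
  | base => exact ⟨Lengths.good_one_zero, Lengths.good_zero_one⟩
  | act m _ ih => exact ⟨ih.1.act m, ih.2.act m⟩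

theorem det (h : Cone a b) : a.1 * b.2 - a.2 * b.1 = 1 := by
  have hφ := Real.goldenRatio_sq
  induction h with
  | base => simp
  | @act m a b _ ih =>
    rw [← ih]
    cases m <;> simp only [Move.act]
    · ring
    · linear_combination (a.1 * b.2 - a.2 * b.1) * hφ
    · linear_combination (a.1 * b.2 - a.2 * b.1) * hφ
    · ring

theorem left_ne (h : Cone a b) : a ≠ 0 := by
  rintro rfl
  simpa using h.det

theorem right_ne (h : Cone a b) : b ≠ 0 := by
  rintro rfl
  simpa using h.det

theorem swap (h : Cone a b) : Cone b.swap a.swap := by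
  induction h with
  | base => exact Cone.base
  | @act m a b _ ih =>
    have e : ∀ (m : Move), ∃ m' : Move, ∀ v, (m.act v).swap = m'.act v.swap := by
      intro m
      cases m
      · exact ⟨.four, fun v => Prod.ext rfl (by simp [Move.act]; ring)⟩
      · exact ⟨.three, fun v => Prod.ext (by simp [Move.act]; ring) (by simp [Move.act]; ring)⟩
      · exact ⟨.two, fun v => Prod.ext (by simp [Move.act]; ring) (by simp [Move.act]; ring)⟩
      · exact ⟨.one, fun v => Prod.ext (by simp [Move.act]; ring) rfl⟩
    obtain ⟨m', hm'⟩ := e m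
    rw [hm', hm']
    exact ih.act m'

/-- This controls how products of moves touch the boundary of the quadrant: only as part of the fan
at `(1, 0)`, with neighbours `(k φ, 1)`. -/
theorem snd_ne_or (h : Cone a b) : b.2 ≠ 0 ∧
    (a.2 = 0 → a = (1, 0) ∧ ∃ k : ℕ, b = (k * Real.goldenRatio, 1)) := by
  have hφ := Real.goldenRatio_pos
  induction h with
  | base => exact ⟨one_ne_zero, fun _ => ⟨rfl, 0, by simp⟩⟩
  | @act m a b hc ih =>
    obtain ⟨⟨ha1, ha2, -⟩, ⟨hb1, hb2, -⟩⟩ := hc.good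
    have na : 0 < a.1 + a.2 := by
      rcases (add_nonneg ha1 ha2).lt_or_eq with g | g
      · exact g
      · exact absurd (Prod.ext (by simp; linarith) (by simp; linarith)) hc.left_ne
    have nb : 0 < b.1 + b.2 := by
      rcases (add_nonneg hb1 hb2).lt_or_eq with g | g
      · exact g
      · exact absurd (Prod.ext (by simp; linarith) (by simp; linarith)) hc.right_ne
    have pa1 := mul_nonneg hφ.le ha1
    have pa2 := mul_nonneg hφ.le ha2
    have pb1 := mul_nonneg hφ.le hb1
    have pb2 := mul_nonneg hφ.le hb2
    have qa := mul_pos hφ na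
    have qb := mul_pos hφ nb
    have b2 : 0 < b.2 := lt_of_le_of_ne hb2 ih.1.symm
    cases m <;> simp only [Move.act]
    · refine ⟨ih.1, fun h0 => ?_⟩
      obtain ⟨e1, k, e2⟩ := ih.2 h0
      refine ⟨by simp [e1], k + 1, ?_⟩
      rw [e2]
      ext
      · push_cast
        ring
      · rfl
    · have := mul_pos hφ b2
      refine ⟨by linarith, fun h0 => ?_⟩
      have h1 : a.1 = 0 := by linarith
      have h2 : a.2 = 0 := by
        have : Real.goldenRatio * a.2 = 0 := by linarith
        exact (mul_eq_zero.1 this).resolve_left hφ.ne'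
      linarith
    · refine ⟨by linarith, fun h0 => ?_⟩
      linarith
    · refine ⟨by linarith, fun h0 => ?_⟩
      have h1 : a.2 = 0 := by linarith
      have h2 : a.1 = 0 := by
        have : Real.goldenRatio * a.1 = 0 := by linarith
        exact (mul_eq_zero.1 this).resolve_left hφ.ne'
      linarith

theorem fst_ne_or (h : Cone a b) : a.1 ≠ 0 ∧
    (b.1 = 0 → b = (0, 1) ∧ ∃ k : ℕ, a = (1, k * Real.goldenRatio)) := by
  obtain ⟨h1, h2⟩ := h.swap.snd_ne_or
  refine ⟨h1, fun h0 => ?_⟩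
  obtain ⟨e1, k, e2⟩ := h2 h0
  exact ⟨Prod.swap_injective e1, k, Prod.swap_injective e2⟩

end Cone

/-- Equality up to sign. -/
def EqNeg (v w : ℝ × ℝ) : Prop := v = w ∨ v = -w

theorem EqNeg.rot {v w : ℝ × ℝ} (h : EqNeg v w) : EqNeg (rot v) (rot w) := by
  rcases h with rfl | rfl
  · exact Or.inl rfl
  · exact Or.inr (rot_neg _)

theorem EqNeg.refl {v w : ℝ × ℝ} (h : EqNeg v w) : EqNeg (refl v) (refl w) := by
  rcases h with rfl | rfl
  · exact Or.inl rfl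
  · exact Or.inr (refl_neg _)

theorem EqNeg.neg_right {v w : ℝ × ℝ} (h : EqNeg v w) : EqNeg v (-w) := by
  rw [EqNeg, neg_neg]
  exact h.symm

/-- The vectors `v` and `u` are, up to signs, the images of a frame inside the interval of
directions under the same rotation. -/
def Placed (v u : ℝ × ℝ) : Prop :=
  ∃ k < 5, ∃ a b, Cone a b ∧ EqNeg v (rot^[k] a) ∧ EqNeg u (rot^[k] b)

/-! ### Moves as reflected rotations, and the position of every frame -/

theorem refl_rot_one (v : ℝ × ℝ) : refl (rot v) = -Move.four.act v.swap := by
  ext <;> simp [refl, rot, Move.act]; ring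

theorem refl_rot_two (v : ℝ × ℝ) : refl (rot (rot v)) = -Move.three.act v.swap := by
  rw [rot_two]
  ext <;> simp [refl, Move.act] <;> ring

theorem refl_rot_three (v : ℝ × ℝ) : refl (rot (rot (rot v))) = -Move.two.act v.swap := by
  rw [rot_three]
  ext <;> simp [refl, Move.act] <;> ring

theorem refl_rot_four (v : ℝ × ℝ) : refl (rot (rot (rot (rot v)))) = -Move.one.act v.swap := by
  rw [rot_four]
  ext <;> simp [refl, Move.act]; ring

theorem refl_act (m : Move) :
    ∃ k < 5, ∀ v : ℝ × ℝ, refl (m.act v) = -rot^[k] v.swap := by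
  cases m
  · refine ⟨4, by norm_num, fun v => ?_⟩
    have := congrArg refl (refl_rot_four v.swap)
    rw [refl_refl, refl_neg, Prod.swap_swap] at this
    exact neg_eq_iff_eq_neg.1 this.symm
  · refine ⟨3, by norm_num, fun v => ?_⟩
    have := congrArg refl (refl_rot_three v.swap)
    rw [refl_refl, refl_neg, Prod.swap_swap] at this
    exact neg_eq_iff_eq_neg.1 this.symm
  · refine ⟨2, by norm_num, fun v => ?_⟩
    have := congrArg refl (refl_rot_two v.swap)
    rw [refl_refl, refl_neg, Prod.swap_swap] at this
    exact neg_eq_iff_eq_neg.1 this.symm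
  · refine ⟨1, by norm_num, fun v => ?_⟩
    have := congrArg refl (refl_rot_one v.swap)
    rw [refl_refl, refl_neg, Prod.swap_swap] at this
    exact neg_eq_iff_eq_neg.1 this.symm

theorem Placed.rot {v u : ℝ × ℝ} (h : Placed v u) : Placed (rot v) (rot u) := by
  obtain ⟨k, hk, a, b, hc, h1, h2⟩ := h
  rcases (Nat.lt_succ_iff_lt_or_eq.1 hk) with hk | rfl
  · refine ⟨k + 1, by omega, a, b, hc, ?_, ?_⟩
    · rw [Function.iterate_succ_apply']
      exact h1.rot
    · rw [Function.iterate_succ_apply']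
      exact h2.rot
  · refine ⟨0, by norm_num, a, b, hc, ?_, ?_⟩
    · have := h1.rot.neg_right
      rwa [show DoublePentagon.rot (DoublePentagon.rot^[4] a) = -a from rot_five a, neg_neg] at this
    · have := h2.rot.neg_right
      rwa [show DoublePentagon.rot (DoublePentagon.rot^[4] b) = -b from rot_five b, neg_neg] at this

/-- After a nontrivial rotation, `refl` adds a move; without rotation it strips the outermost move
and leaves a rotation. The swap of coordinates in these identities exchanges the two vectors. -/
theorem Placed.refl {v u : ℝ × ℝ} (h : Placed v u) :
    Placed (refl v) (refl u) ∨ Placed (refl u) (refl v) := by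
  obtain ⟨k, hk, a, b, hc, h1, h2⟩ := h
  have h1 := h1.refl
  have h2 := h2.refl
  have key : ∀ m : Move, (∀ w : ℝ × ℝ, DoublePentagon.refl (DoublePentagon.rot^[k] w) =
      -m.act w.swap) → Placed (DoublePentagon.refl u) (DoublePentagon.refl v) := by
    intro m hm
    rw [hm] at h1 h2
    refine ⟨0, by norm_num, _, _, hc.swap.act m, ?_, ?_⟩
    · simpa using h2.neg_right
    · simpa using h1.neg_right
  interval_cases k
  -- With no move to strip, the pair is the base side, which `refl` fixes up to signs.
  · cases hc with
    | base =>
      left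
      refine ⟨0, by norm_num, _, _, Cone.base, ?_, ?_⟩
      · simpa [DoublePentagon.refl] using h1
      · have := h2.neg_right
        simpa [DoublePentagon.refl] using this
    | @act m a b hc =>
      right
      obtain ⟨k, hk, hm⟩ := refl_act m
      refine ⟨k, hk, _, _, hc.swap, ?_, ?_⟩
      · rw [Function.iterate_zero, id, hm] at h2
        simpa using h2.neg_right
      · rw [Function.iterate_zero, id, hm] at h1
        simpa using h1.neg_right
  · exact Or.inr (key .four refl_rot_one)
  · exact Or.inr (key .three refl_rot_two)
  · exact Or.inr (key .two refl_rot_three)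
  · exact Or.inr (key .one refl_rot_four)

theorem Frame.placed {v u : ℝ × ℝ} (h : Frame v u) : Placed v u ∨ Placed u v := by
  induction h with
  | base => exact Or.inl ⟨0, by norm_num, _, _, Cone.base, Or.inl rfl, Or.inl rfl⟩
  | rot _ ih => exact ih.imp Placed.rot Placed.rot
  | refl _ ih =>
    rcases ih with ih | ih
    · exact ih.refl
    · exact ih.refl.symm

theorem Adj.placed {v u : ℝ × ℝ} (h : Adj v u) : Placed v u ∨ Placed u v := by
  rcases h with h | h
  · exact h.placed
  · exact h.placed.symm

/-- The rotations by nonzero angles move the interval of directions off itself. -/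
theorem rot_iterate_cases {a : ℝ × ℝ} (h1 : 0 ≤ a.1) (h2 : 0 ≤ a.2) (ha : a ≠ 0) {k : ℕ}
    (hk : k < 5) :
    k = 0 ∨ ((rot^[k] a).1 ≤ 0 ∧ 0 ≤ (rot^[k] a).2 ∧
      ((rot^[k] a).1 = 0 → k = 1 ∧ a.2 = 0) ∧ ((rot^[k] a).2 = 0 → k = 4 ∧ a.1 = 0)) := by
  have hφ := Real.goldenRatio_pos
  have na : 0 < a.1 + a.2 := by
    rcases (add_nonneg h1 h2).lt_or_eq with g | g
    · exact g
    · exact absurd (Prod.ext (by simp; linarith) (by simp; linarith)) ha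
  have p1 := mul_nonneg hφ.le h1
  have p2 := mul_nonneg hφ.le h2
  have q := mul_pos hφ na
  have hz : a.1 + Real.goldenRatio * a.2 ≠ 0 := by
    intro h0
    have h1 : a.1 = 0 := by linarith
    have h2 : a.2 = 0 := by
      have : Real.goldenRatio * a.2 = 0 := by linarith
      exact (mul_eq_zero.1 this).resolve_left hφ.ne'
    linarith
  have hz' : Real.goldenRatio * a.1 + a.2 ≠ 0 := by
    intro h0
    have h1 : a.2 = 0 := by linarith
    have h2 : a.1 = 0 := by
      have : Real.goldenRatio * a.1 = 0 := by linarith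
      exact (mul_eq_zero.1 this).resolve_left hφ.ne'
    linarith
  interval_cases k
  · exact Or.inl rfl
  · right
    show -a.2 ≤ 0 ∧ 0 ≤ a.1 + Real.goldenRatio * a.2 ∧ (-a.2 = 0 → _) ∧
      (a.1 + Real.goldenRatio * a.2 = 0 → _)
    exact ⟨by linarith, by linarith, fun h => ⟨rfl, by linarith⟩, fun h => absurd h hz⟩
  · right
    rw [show rot^[2] a = rot (rot a) from rfl, rot_two]
    refine ⟨?_, ?_, fun h => ?_, fun h => ?_⟩ <;> simp only at *
    · linarith
    · linarith
    · exact absurd (neg_eq_zero.1 h) hz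
    · linarith
  · right
    rw [show rot^[3] a = rot (rot (rot a)) from rfl, rot_three]
    refine ⟨?_, ?_, fun h => ?_, fun h => ?_⟩ <;> simp only at *
    · linarith
    · linarith
    · linarith
    · exact absurd h hz'
  · right
    rw [show rot^[4] a = rot (rot (rot (rot a))) from rfl, rot_four]
    refine ⟨?_, ?_, fun h => ?_, fun h => ?_⟩ <;> simp only at *
    · linarith
    · linarith
    · exact absurd (neg_eq_zero.1 h) hz'
    · exact ⟨trivial, h⟩

/-- A vector of a frame that lies in the first quadrant is a good pair of parameters. -/
theorem good_of_eqNeg {a v : ℝ × ℝ} (ha : Lengths.Good a.1 a.2) (ne : a ≠ 0)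
    (h1 : a.2 = 0 → a = (1, 0)) (h2 : a.1 = 0 → a = (0, 1)) {k : ℕ} (hk : k < 5)
    (h : EqNeg v (rot^[k] a)) (v1 : 0 ≤ v.1) (v2 : 0 ≤ v.2) : Lengths.Good v.1 v.2 := by
  rcases rot_iterate_cases ha.1 ha.2.1 ne hk with rfl | ⟨r1, r2, r3, r4⟩
  · rcases h with rfl | rfl
    · exact ha
    · simp only [Function.iterate_zero, id, Prod.fst_neg, Prod.snd_neg] at v1 v2
      exact absurd (Prod.ext (by simp; linarith [ha.1]) (by simp; linarith [ha.2.1])) ne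
  · rcases h with rfl | rfl
    · obtain ⟨rfl, e⟩ := r3 (le_antisymm r1 v1)
      rw [h1 e]
      simpa [rot] using Lengths.good_zero_one
    · simp only [Prod.fst_neg, Prod.snd_neg] at v1 v2
      obtain ⟨rfl, e⟩ := r4 (by linarith)
      rw [h2 e, show rot^[4] (0, 1) = rot (rot (rot (rot (0, 1)))) from rfl, rot_four]
      simpa using Lengths.good_one_zero

theorem Placed.good {v u : ℝ × ℝ} (h : Placed v u) :
    (0 ≤ v.1 → 0 ≤ v.2 → Lengths.Good v.1 v.2) ∧ (0 ≤ u.1 → 0 ≤ u.2 → Lengths.Good u.1 u.2) := by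
  obtain ⟨k, hk, a, b, hc, h1, h2⟩ := h
  exact ⟨good_of_eqNeg hc.good.1 hc.left_ne (fun e => (hc.snd_ne_or.2 e).1)
    (fun e => absurd e hc.fst_ne_or.1) hk h1, good_of_eqNeg hc.good.2 hc.right_ne
    (fun e => absurd e hc.snd_ne_or.1) (fun e => (hc.fst_ne_or.2 e).1) hk h2⟩

theorem Adj.good {v u : ℝ × ℝ} (h : Adj v u) :
    (0 ≤ v.1 → 0 ≤ v.2 → Lengths.Good v.1 v.2) ∧ (0 ≤ u.1 → 0 ≤ u.2 → Lengths.Good u.1 u.2) := by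
  rcases h.placed with g | g
  · exact g.good
  · exact g.good.symm

theorem EqNeg.mul_eq {v w : ℝ × ℝ} (h : EqNeg v w) : v.1 * v.2 = w.1 * w.2 := by
  rcases h with rfl | rfl
  · rfl
  · simp

/-- The sides with an end inside the interval of directions have the other end in its closure. -/
theorem Adj.mul_nonneg {v u : ℝ × ℝ} (h : Adj v u) (hv : 0 < v.1 * v.2) : 0 ≤ u.1 * u.2 := by
  have key : ∀ {a b : ℝ × ℝ} {k : ℕ}, Lengths.Good a.1 a.2 → a ≠ 0 → Lengths.Good b.1 b.2 →
      k < 5 → EqNeg v (DoublePentagon.rot^[k] a) → EqNeg u (DoublePentagon.rot^[k] b) → 0 ≤ u.1 * u.2 := by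
    intro a b k ha ne hb hk h1 h2
    rcases rot_iterate_cases ha.1 ha.2.1 ne hk with rfl | ⟨r1, r2, -, -⟩
    · rw [h2.mul_eq]
      exact _root_.mul_nonneg hb.1 hb.2.1
    · rw [h1.mul_eq] at hv
      exact absurd hv (not_lt.2 (mul_nonpos_of_nonpos_of_nonneg r1 r2))
  rcases h.placed with ⟨k, hk, a, b, hc, h1, h2⟩ | ⟨k, hk, a, b, hc, h1, h2⟩
  · exact key hc.good.1 hc.left_ne hc.good.2 hk h1 h2
  · exact key hc.good.2 hc.right_ne hc.good.1 hk h2 h1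

/-! ### The fan of a tiling vertex -/

theorem EqNeg.snd_eq_zero {v w : ℝ × ℝ} (h : EqNeg v w) (hv : v.2 = 0) : w.2 = 0 := by
  rcases h with rfl | rfl
  · exact hv
  · simpa using hv

/-- The direction `(1, 0)` lies in the closures of two rotated quadrants only: the unrotated one
gives the neighbours with `k ≥ 0`, the one rotated four times those with `k < 0`. -/
theorem Adj.eqNeg_of_snd_eq_zero {v u : ℝ × ℝ} (h : Adj v u) (hv : v.2 = 0) :
    ∃ k : ℤ, EqNeg u (k * Real.goldenRatio, 1) := by
  rcases h.placed with ⟨k, hk, a, b, hc, h1, h2⟩ | ⟨k, hk, a, b, hc, h1, h2⟩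
  · rcases rot_iterate_cases hc.good.1.1 hc.good.1.2.1 hc.left_ne hk with rfl | ⟨-, -, -, r4⟩
    · obtain ⟨-, n, e⟩ := hc.snd_ne_or.2 (h1.snd_eq_zero hv)
      rw [e] at h2
      exact ⟨n, by simpa using h2⟩
    · exact absurd (r4 (h1.snd_eq_zero hv)).2 hc.fst_ne_or.1
  · rcases rot_iterate_cases hc.good.2.1 hc.good.2.2.1 hc.right_ne hk with rfl | ⟨-, -, -, r4⟩
    · exact absurd (h2.snd_eq_zero hv) hc.snd_ne_or.1
    · obtain ⟨rfl, e⟩ := r4 (h2.snd_eq_zero hv)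
      obtain ⟨-, n, e⟩ := hc.fst_ne_or.2 e
      have hr := rot_four (1, (n : ℝ) * Real.goldenRatio)
      rw [e] at h1
      change EqNeg u (DoublePentagon.rot (DoublePentagon.rot (DoublePentagon.rot
        (DoublePentagon.rot (1, (n : ℝ) * Real.goldenRatio))))) at h1
      rw [hr] at h1
      refine ⟨-(n + 1), ?_⟩
      convert h1 using 2
      push_cast
      ring

/-- The points joined to a vertex form a fan. -/
theorem Frame.eqNeg_of_adj {v u : ℝ × ℝ} (h : Frame v u) : ∀ {v' u' : ℝ × ℝ} {c : ℝ},
    Adj v' u' → v' = c • v → ∃ k : ℤ, EqNeg u' (u + (k * Real.goldenRatio) • v) := by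
  induction h with
  | base =>
    intro v' u' c ha hv
    obtain ⟨k, hk⟩ := ha.eqNeg_of_snd_eq_zero (by simp [hv])
    exact ⟨k, by simpa using hk⟩
  | @rot v u _ ih =>
    intro v' u' c ha hv
    -- Four more rotations undo `rot` up to sign, so the induction hypothesis applies; one further
    -- rotation returns to `u'`.
    have e : DoublePentagon.rot (DoublePentagon.rot (DoublePentagon.rot (DoublePentagon.rot v'))) =
        (-c) • v := by
      have hr : ∀ w : ℝ × ℝ, DoublePentagon.rot (c • w) = c • DoublePentagon.rot w := by
        intro w
        have := rot_add_smul 0 w c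
        simpa [DoublePentagon.rot] using this
      rw [hv, hr, hr, hr, hr, rot_five]
      simp
    obtain ⟨k, hk⟩ := ih ha.rot.rot.rot.rot e
    refine ⟨k, ?_⟩
    have := hk.rot
    rw [rot_five, rot_add_smul] at this
    rcases this with h | h
    · exact Or.inr (neg_eq_iff_eq_neg.1 h)
    · exact Or.inl (neg_injective h)
  | @refl v u _ ih =>
    intro v' u' c ha hv
    have e : DoublePentagon.refl v' = c • v := by
      rw [hv]
      ext <;> simp [DoublePentagon.refl]
    obtain ⟨k, hk⟩ := ih ha.refl e
    refine ⟨k, ?_⟩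
    have := hk.refl
    rwa [refl_refl, refl_add_smul] at this

theorem Frame.joinedBySide_iff {v u : ℝ × ℝ} (h : Frame v u) {y : OnePoint ℝ} :
    JoinedBySide (proj v) y ↔ ∃ k : ℤ, y = proj (u + (k * Real.goldenRatio) • v) := by
  rw [DoublePentagon.joinedBySide_iff]
  constructor
  · rintro ⟨v', u', ha, e1, rfl⟩
    obtain ⟨c, hc⟩ := exists_smul_of_proj_eq h.left_ne e1.symm
    obtain ⟨k, hk⟩ := h.eqNeg_of_adj ha hc
    refine ⟨k, ?_⟩
    rcases hk with rfl | rfl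
    · rfl
    · rw [proj_neg]
  · rintro ⟨k, rfl⟩
    exact ⟨v, _, Adj.add_int_smul (Or.inl h) k, rfl, rfl⟩

/-! ### Periods of the tiling vertices -/

theorem coord_neg (v : ℝ × ℝ) : coord (-v) = coord v := by
  rw [coord, coord, ← neg_div_neg_eq]
  simp only [Prod.fst_neg, Prod.snd_neg]
  congr 1 <;> ring

theorem parS_coord {v : ℝ × ℝ} (hv : v.1 + v.2 ≠ 0) : parS (coord v) =
    (Real.goldenRatio - 1 / 2) * (2 * corner) / (v.1 + v.2) * v.1 := by
  rw [parS, coord, ← corner]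
  field_simp
  ring

theorem parT_coord {v : ℝ × ℝ} (hv : v.1 + v.2 ≠ 0) : parT (coord v) =
    (Real.goldenRatio - 1 / 2) * (2 * corner) / (v.1 + v.2) * v.2 := by
  rw [parT, coord, ← corner]
  field_simp
  ring

theorem isPeriodPair_coord {v : ℝ × ℝ} (h : Lengths.Good v.1 v.2) (hv : 0 < v.1 + v.2) :
    ∃ a A : ℕ, (a : ℝ) + A * Real.goldenRatio = Real.goldenRatio ^ 2 * (v.1 + v.2) ∧
      IsPeriodPair (intervalWords (coord v)) a A ∧
      IsPeriodPair (sideWords (coord v)) (2 * a) (2 * A) := by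
  obtain ⟨a, A, e, hp⟩ := h.isPeriodPair
  have hk : 0 < (Real.goldenRatio - 1 / 2) * (2 * corner) / (v.1 + v.2) := by
    have := goldenRatio_bounds.1
    have := corner_pos
    exact div_pos (mul_pos (by linarith) (by linarith)) hv
  have hs : 0 ≤ parS (coord v) := by
    rw [parS_coord hv.ne']
    exact mul_nonneg hk.le h.1
  have ht : 0 ≤ parT (coord v) := by
    rw [parT_coord hv.ne']
    exact mul_nonneg hk.le h.2.1
  have hI : IsPeriodPair (intervalWords (coord v)) a A := by
    rw [intervalWords_eq hs ht, parS_coord hv.ne', parT_coord hv.ne', Lengths.words_smul hk]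
    exact hp.image Letter.sides_injective
  exact ⟨a, A, e, hI, sideWords_isPeriodPair hs ht hI⟩

theorem eq_of_add_mul_goldenRatio {m n m' n' : ℤ}
    (h : (m : ℝ) + n * Real.goldenRatio = m' + n' * Real.goldenRatio) : m = m' ∧ n = n' := by
  have hn : n = n' := by
    by_contra hne
    have hne' : ((n - n' : ℤ) : ℝ) ≠ 0 := by
      exact_mod_cast sub_ne_zero.2 hne
    refine Real.goldenRatio_irrational ⟨((m' - m : ℤ) : ℚ) / ((n - n' : ℤ) : ℚ), ?_⟩
    push_cast at hne' ⊢
    rw [div_eq_iff hne']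
    linarith
  subst hn
  exact ⟨by exact_mod_cast add_right_cancel h, rfl⟩

/-- The periods of the members of a list of directions form an arithmetic sequence. -/
def ArithmeticPeriods (β : ℝ) (γ : ℤ → ℝ) : Prop :=
  ∃ (b B : ℕ) (c C : ℤ → ℕ), IsPeriodPair (intervalWords β) b B ∧
    IsPeriodPair (sideWords β) (2 * b) (2 * B) ∧
    ∀ i, IsPeriodPair (intervalWords (γ i)) (c i) (C i) ∧
      IsPeriodPair (sideWords (γ i)) (2 * c i) (2 * C i) ∧
      signed c (i + 1) - signed c i = (B : ℤ) ∧ signed C (i + 1) - signed C i = (b : ℤ) + (B : ℤ)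

theorem ArithmeticPeriods.reverse {β : ℝ} {γ : ℤ → ℝ} (h : ArithmeticPeriods β γ) :
    ArithmeticPeriods β (fun i => γ (-1 - i)) := by
  obtain ⟨b, B, c, C, h1, h2, h3⟩ := h
  -- The reversal `i ↦ -1 - i` exchanges the indices `≥ 0` with those `< 0`, so it negates the
  -- signed sequence and keeps its differences.
  have hs : ∀ (c : ℤ → ℕ) (i : ℤ), signed (fun i => c (-1 - i)) i = -signed c (-1 - i) := by
    intro c i
    simp only [signed]
    split_ifs <;> omega
  refine ⟨b, B, _, _, h1, h2, fun i => ⟨(h3 (-1 - i)).1, (h3 (-1 - i)).2.1, ?_, ?_⟩⟩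
  · have := (h3 (-1 - (i + 1))).2.2.1
    rw [hs, hs, ← this, show -1 - (i + 1) + 1 = -1 - i by ring]
    ring
  · have := (h3 (-1 - (i + 1))).2.2.2
    rw [hs, hs, ← this, show -1 - (i + 1) + 1 = -1 - i by ring]
    ring

theorem signed_two_mul (c : ℤ → ℕ) (i : ℤ) : signed (fun i => 2 * c i) i = 2 * signed c i := by
  simp only [signed]
  split_ifs <;> push_cast <;> ring

/-! ### Fans -/

theorem IsFan.reverse {β : ℝ} {γ : ℤ → ℝ} (h : IsFan β γ) : IsFan β (fun i => γ (-1 - i)) := by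
  refine ⟨fun y => ?_, ?_⟩
  · rw [h.joined_iff]
    constructor
    · rintro ⟨i, hi⟩
      exact ⟨-1 - i, by rw [hi, sub_sub_cancel]⟩
    · rintro ⟨i, hi⟩
      exact ⟨_, hi⟩
  · rcases h.ordered with ⟨h1, h2, h3, h4⟩ | ⟨h1, h2, h3, h4⟩
    · refine Or.inr ⟨fun i hi => h2 _ (by omega), fun i hi => h1 _ (by omega), ?_, ?_⟩
      · intro i hi j hj hij
        simp only [Set.mem_Ici] at hi hj
        exact h4 (show -1 - j < 0 by omega) (show -1 - i < 0 by omega) (by omega)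
      · intro i hi j hj hij
        simp only [Set.mem_Iio] at hi hj
        exact h3 (show 0 ≤ -1 - j by omega) (show 0 ≤ -1 - i by omega) (by omega)
    · refine Or.inl ⟨fun i hi => h2 _ (by omega), fun i hi => h1 _ (by omega), ?_, ?_⟩
      · intro i hi j hj hij
        simp only [Set.mem_Ici] at hi hj
        exact h4 (show -1 - j < 0 by omega) (show -1 - i < 0 by omega) (by omega)
      · intro i hi j hj hij
        simp only [Set.mem_Iio] at hi hj
        exact h3 (show 0 ≤ -1 - j by omega) (show 0 ≤ -1 - i by omega) (by omega)

/-- A fan whose right part comes first. -/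
def IsRightFan (β : ℝ) (γ : ℤ → ℝ) : Prop :=
  (∀ i, 0 ≤ i → β < γ i) ∧ (∀ i, i < 0 → γ i < β) ∧
    StrictAntiOn γ (Set.Ici 0) ∧ StrictAntiOn γ (Set.Iio 0)

theorem IsFan.right_or {β : ℝ} {γ : ℤ → ℝ} (h : IsFan β γ) :
    IsRightFan β γ ∨ IsRightFan β (fun i => γ (-1 - i)) := by
  rcases h.ordered with h1 | ⟨h1, h2, h3, h4⟩
  · exact Or.inl h1
  · refine Or.inr ⟨fun i hi => h2 _ (by omega), fun i hi => h1 _ (by omega), ?_, ?_⟩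
    · intro i hi j hj hij
      simp only [Set.mem_Ici] at hi hj
      exact h4 (show -1 - j < 0 by omega) (show -1 - i < 0 by omega) (by omega)
    · intro i hi j hj hij
      simp only [Set.mem_Iio] at hi hj
      exact h3 (show 0 ≤ -1 - j by omega) (show 0 ≤ -1 - i by omega) (by omega)

/-- The position relative to `β` separates the two halves, and a strictly monotone sequence on `ℕ`
is determined by its range. -/
theorem IsRightFan.eq {β : ℝ} {γ γ' : ℤ → ℝ} (h : IsRightFan β γ) (h' : IsRightFan β γ')
    (hr : Set.range γ = Set.range γ') : γ = γ' := by
  have sub : ∀ {γ γ' : ℤ → ℝ}, IsRightFan β γ → IsRightFan β γ' → Set.range γ = Set.range γ' →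
      Set.range (fun n : ℕ => -γ n) ⊆ Set.range (fun n : ℕ => -γ' n) ∧
      Set.range (fun n : ℕ => γ (-1 - n)) ⊆ Set.range (fun n : ℕ => γ' (-1 - n)) := by
    intro γ γ' h h' hr
    constructor
    · rintro _ ⟨n, rfl⟩
      obtain ⟨i, hi⟩ : γ n ∈ Set.range γ' := hr ▸ Set.mem_range_self _
      have hi0 : 0 ≤ i := by
        by_contra hn
        have := h.1 n (by omega)
        have := h'.2.1 i (by omega)
        linarith
      exact ⟨i.toNat, by simp only [Int.toNat_of_nonneg hi0, hi]⟩
    · rintro _ ⟨n, rfl⟩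
      obtain ⟨i, hi⟩ : γ (-1 - n) ∈ Set.range γ' := hr ▸ Set.mem_range_self _
      have hi0 : i < 0 := by
        by_contra hn
        have := h.2.1 (-1 - n) (by omega)
        have := h'.1 i (by omega)
        linarith
      refine ⟨(-1 - i).toNat, ?_⟩
      simp only [Int.toNat_of_nonneg (show 0 ≤ -1 - i by omega), sub_sub_cancel, hi]
  have mono : ∀ {γ : ℤ → ℝ}, IsRightFan β γ →
      StrictMono (fun n : ℕ => -γ n) ∧ StrictMono (fun n : ℕ => γ (-1 - n)) := by
    intro γ h
    constructor
    · intro m n hmn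
      exact neg_lt_neg (h.2.2.1 (show (0 : ℤ) ≤ m by omega) (show (0 : ℤ) ≤ n by omega)
        (by omega))
    · intro m n hmn
      exact h.2.2.2 (show -1 - (n : ℤ) < 0 by omega) (show -1 - (m : ℤ) < 0 by omega) (by omega)
  have e1 := (StrictMono.range_inj (mono h).1 (mono h').1).1
    (Set.Subset.antisymm (sub h h' hr).1 (sub h' h hr.symm).1)
  have e2 := (StrictMono.range_inj (mono h).2 (mono h').2).1
    (Set.Subset.antisymm (sub h h' hr).2 (sub h' h hr.symm).2)
  funext i
  rcases lt_or_ge i 0 with hi | hi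
  · have := congrFun e2 (-1 - i).toNat
    simpa only [Int.toNat_of_nonneg (show 0 ≤ -1 - i by omega), sub_sub_cancel] using this
  · have := congrFun e1 i.toNat
    simpa only [Int.toNat_of_nonneg hi, neg_inj] using this

theorem IsFan.range_eq {β : ℝ} {γ γ' : ℤ → ℝ} (h : IsFan β γ) (h' : IsFan β γ') :
    Set.range γ = Set.range γ' := by
  have key : ∀ {γ γ' : ℤ → ℝ}, IsFan β γ → IsFan β γ' → Set.range γ ⊆ Set.range γ' := by
    rintro γ γ' h h' _ ⟨i, rfl⟩
    obtain ⟨j, hj⟩ := (h'.joined_iff _).1 ((h.joined_iff _).2 ⟨i, rfl⟩)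
    exact ⟨j, (OnePoint.coe_eq_coe.1 hj).symm⟩
  exact Set.Subset.antisymm (key h h') (key h' h)

/-- A list of the points joined to `β` is determined up to reversal. -/
theorem IsFan.eq_or_eq_reverse {β : ℝ} {γ γ' : ℤ → ℝ} (h : IsFan β γ) (h' : IsFan β γ') :
    γ' = γ ∨ γ' = fun i => γ (-1 - i) := by
  have rev : ∀ {γ γ' : ℤ → ℝ}, (fun i => γ' (-1 - i)) = γ → γ' = fun i => γ (-1 - i) := by
    rintro γ γ' rfl
    funext i
    show γ' i = γ' (-1 - (-1 - i))
    rw [sub_sub_cancel]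
  rcases h.right_or with g | g <;> rcases h'.right_or with g' | g'
  · exact Or.inl (g'.eq g (h'.range_eq h))
  · exact Or.inr (rev (g'.eq g (h'.reverse.range_eq h)))
  · exact Or.inr (g'.eq g (h'.range_eq h.reverse))
  · refine Or.inl ?_
    have := rev (g'.eq g (h'.reverse.range_eq h.reverse))
    simpa only [sub_sub_cancel] using this

/-- The fan of a vertex inside the interval of directions. -/
theorem exists_fan {β : ℝ} (hβ : IsTilingVertex (β : OnePoint ℝ))
    (hmem : β ∈ Set.Ioo (-corner) corner) : ∃ γ, IsFan β γ ∧ ArithmeticPeriods β γ := by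
  have hφ := Real.goldenRatio_pos
  have hφ2 := Real.goldenRatio_sq
  have hc := corner_pos
  obtain ⟨v, u, hf, hv0, hβv⟩ : ∃ v u, Frame v u ∧ 0 ≤ v.1 + v.2 ∧ (β : OnePoint ℝ) = proj v := by
    obtain ⟨v, u, hf, e⟩ := hβ.exists_frame
    rcases le_total 0 (v.1 + v.2) with h | h
    · exact ⟨v, u, hf, h, e⟩
    · refine ⟨-v, -u, hf.neg, ?_, by rw [e, proj_neg]⟩
      simp only [Prod.fst_neg, Prod.snd_neg]
      linarith
  have hv : 0 < v.1 + v.2 := by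
    refine lt_of_le_of_ne hv0 fun h0 => ?_
    rw [proj, homog, if_pos h0.symm] at hβv
    exact OnePoint.coe_ne_infty _ hβv
  have hβc : β = coord v := by
    rw [proj_eq_coord hv.ne'] at hβv
    exact OnePoint.coe_eq_coe.1 hβv
  obtain ⟨hv1, hv2⟩ : 0 < v.1 ∧ 0 < v.2 := by
    obtain ⟨h1, h2⟩ := hmem
    rw [hβc, coord] at h1 h2
    rw [lt_div_iff₀ hv] at h1
    rw [div_lt_iff₀ hv] at h2
    constructor
    · by_contra! hn
      have := mul_nonneg hc.le (neg_nonneg.2 hn)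
      linarith
    · by_contra! hn
      have := mul_nonneg hc.le (neg_nonneg.2 hn)
      linarith
  have hφv : 0 < Real.goldenRatio * (v.1 + v.2) := mul_pos hφ hv
  set W : ℤ → ℝ × ℝ := fun k => u + (k * Real.goldenRatio) • v with hW
  have hσ : ∀ k, (W k).1 + (W k).2 = u.1 + u.2 + k * (Real.goldenRatio * (v.1 + v.2)) := by
    intro k
    simp [hW]
    ring
  have hdet : ∀ k, v.1 * (W k).2 - v.2 * (W k).1 = v.1 * u.2 - v.2 * u.1 := by
    intro k
    simp [hW]
    ring
  have hadj : ∀ k, Adj v (W k) := fun k => Adj.add_int_smul (Or.inl hf) k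
  have hsign : ∀ k, 0 ≤ (W k).1 * (W k).2 := fun k => (hadj k).mul_nonneg (mul_pos hv1 hv2)
  -- With zero sum, the nonnegative product of coordinates would make `W k` vanish, against the
  -- determinant `±1`. Hence no neighbour is `∞`.
  have hne : ∀ k, (W k).1 + (W k).2 ≠ 0 := by
    intro k h0
    have h1 := hsign k
    have e : (W k).2 = -(W k).1 := by linarith
    rw [e] at h1
    have h2 : (W k).1 = 0 := by nlinarith
    have h3 := hdet k
    rw [e, h2] at h3
    rcases hf.det with h | h <;> rw [h] at h3 <;> norm_num at h3
  have hpos : ∀ {w : ℝ × ℝ}, 0 ≤ w.1 * w.2 → 0 < w.1 + w.2 → 0 ≤ w.1 ∧ 0 ≤ w.2 := by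
    intro w h1 h2
    constructor <;> by_contra! hn <;> nlinarith
  -- The coordinate sums increase linearly in `k`; `k₀` is where they become positive, so it
  -- receives the index `0`.
  obtain ⟨k₀, hk₀, hk₁⟩ : ∃ k₀ : ℤ, 0 < (W k₀).1 + (W k₀).2 ∧
      (W (k₀ - 1)).1 + (W (k₀ - 1)).2 < 0 := by
    refine ⟨⌈-(u.1 + u.2) / (Real.goldenRatio * (v.1 + v.2))⌉,
      lt_of_le_of_ne ?_ (hne _).symm, ?_⟩
    · have := Int.le_ceil (-(u.1 + u.2) / (Real.goldenRatio * (v.1 + v.2)))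
      rw [div_le_iff₀ hφv] at this
      rw [hσ]
      linarith
    · have := Int.ceil_lt_add_one (-(u.1 + u.2) / (Real.goldenRatio * (v.1 + v.2)))
      rw [← sub_lt_iff_lt_add, lt_div_iff₀ hφv] at this
      rw [hσ]
      push_cast
      linarith
  set σ : ℤ → ℝ := fun i => (W (k₀ + i)).1 + (W (k₀ + i)).2 with hσd
  have σmono : ∀ {i j : ℤ}, i < j → σ i < σ j := by
    intro i j hij
    have : (i : ℝ) < j := by exact_mod_cast hij
    simp only [hσd, hσ]
    push_cast
    nlinarith
  have σpos : ∀ i, 0 ≤ i → 0 < σ i := by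
    intro i hi
    have h0 : 0 < σ 0 := by simpa [hσd] using hk₀
    rcases hi.eq_or_lt with rfl | h
    · exact h0
    · exact h0.trans (σmono h)
  have σneg : ∀ i, i < 0 → σ i < 0 := by
    intro i hi
    have h0 : σ (-1) < 0 := hk₁
    rcases (show i = -1 ∨ i < -1 by omega) with rfl | h
    · exact h0
    · exact (σmono h).trans h0
  -- The distance to `β` is a constant over `σ i`. So the sign of `σ` picks the side of `β`, its
  -- growth gives the order of approach, and the sign of the determinant tells which side comes
  -- first.
  have hdiff : ∀ i, coord (W (k₀ + i)) =
      β + 2 * corner / (v.1 + v.2) * (v.1 * u.2 - v.2 * u.1) / σ i := by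
    intro i
    have := hne (k₀ + i)
    rw [hβc, ← hdet (k₀ + i), coord, coord]
    simp only [hσd]
    field_simp
    ring
  have hK : 0 < 2 * corner / (v.1 + v.2) := div_pos (by linarith) hv
  have decr : ∀ {K : ℝ}, 0 < K → (∀ i, 0 ≤ i → 0 < K / σ i) ∧ (∀ i, i < 0 → K / σ i < 0) ∧
      StrictAntiOn (fun i => K / σ i) (Set.Ici 0) ∧
      StrictAntiOn (fun i => K / σ i) (Set.Iio 0) := by
    intro K hK
    refine ⟨fun i hi => div_pos hK (σpos i hi), fun i hi => div_neg_of_pos_of_neg hK (σneg i hi),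
      ?_, ?_⟩
    · intro i hi j hj hij
      exact div_lt_div_of_pos_left hK (σpos i hi) (σmono hij)
    · intro i hi j hj hij
      have := div_lt_div_of_pos_left hK (neg_pos.2 (σneg j hj)) (neg_lt_neg (σmono hij))
      rw [div_neg, div_neg] at this
      exact neg_lt_neg_iff.1 this
  refine ⟨fun i => coord (W (k₀ + i)), ⟨fun y => ?_, ?_⟩, ?_⟩
  · rw [hβv, hf.joinedBySide_iff]
    constructor
    · rintro ⟨k, rfl⟩
      refine ⟨k - k₀, ?_⟩
      rw [add_sub_cancel]
      exact proj_eq_coord (hne k)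
    · rintro ⟨i, rfl⟩
      exact ⟨k₀ + i, (proj_eq_coord (hne _)).symm⟩
  · obtain ⟨d1, d2, d3, d4⟩ := decr hK
    simp only [hdiff]
    rcases hf.det with h | h <;> simp only [h, mul_one, mul_neg, neg_div]
    · refine Or.inl ⟨fun i hi => ?_, fun i hi => ?_, fun i hi j hj hij => ?_,
        fun i hi j hj hij => ?_⟩
      · linarith [d1 i hi]
      · linarith [d2 i hi]
      · have := d3 hi hj hij
        simp only at this
        linarith
      · have := d4 hi hj hij
        simp only at this
        linarith
    · refine Or.inr ⟨fun i hi => ?_, fun i hi => ?_, fun i hi j hj hij => ?_,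
        fun i hi j hj hij => ?_⟩
      · linarith [d1 i hi]
      · linarith [d2 i hi]
      · have := d3 hi hj hij
        simp only at this
        linarith
      · have := d4 hi hj hij
        simp only at this
        linarith
  · obtain ⟨b, B, e, hb⟩ := isPeriodPair_coord ((hadj 0).good.1 hv1.le hv2.le) hv
    -- For `i < 0` the vector `-W (k₀ + i)` lies in the closed quadrant and represents the same
    -- direction.
    have hper : ∀ i, ∃ c C : ℕ, ((c : ℝ) + C * Real.goldenRatio =
        Real.goldenRatio ^ 2 * (if i < 0 then -σ i else σ i)) ∧
        IsPeriodPair (intervalWords (coord (W (k₀ + i)))) c C ∧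
        IsPeriodPair (sideWords (coord (W (k₀ + i)))) (2 * c) (2 * C) := by
      intro i
      split_ifs with hi
      · have hp : 0 < (-W (k₀ + i)).1 + (-W (k₀ + i)).2 := by
          have := σneg i hi
          simp only [hσd] at this
          simp only [Prod.fst_neg, Prod.snd_neg]
          linarith
        have hq := hpos (w := -W (k₀ + i)) (by simpa using hsign (k₀ + i)) hp
        obtain ⟨c, C, e, hcC⟩ := isPeriodPair_coord ((hadj _).neg_right.good.2 hq.1 hq.2) hp
        rw [coord_neg] at hcC
        refine ⟨c, C, ?_, hcC⟩
        rw [e]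
        simp only [hσd, Prod.fst_neg, Prod.snd_neg]
        ring
      · have hp := σpos i (not_lt.1 hi)
        have hq := hpos (hsign (k₀ + i)) hp
        exact isPeriodPair_coord ((hadj _).good.2 hq.1 hq.2) hp
    choose c C hcC using hper
    have hsg : ∀ i, (signed c i : ℝ) + signed C i * Real.goldenRatio =
        Real.goldenRatio ^ 2 * σ i := by
      intro i
      have := (hcC i).1
      simp only [signed]
      split_ifs at this ⊢ <;> push_cast <;> linarith
    have hstep : ∀ i, signed c (i + 1) = signed c i + B ∧
        signed C (i + 1) = signed C i + (b + B) := by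
      intro i
      apply eq_of_add_mul_goldenRatio
      push_cast
      have e1 := hsg i
      have e2 := hsg (i + 1)
      have e3 : σ (i + 1) = σ i + Real.goldenRatio * (v.1 + v.2) := by
        simp only [hσd, hσ]
        push_cast
        ring
      rw [e3] at e2
      -- The increment of `φ ^ 2 σ` is `φ (b + B φ)`, which reduces to `B + (b + B) φ`.
      linear_combination e2 - e1 - Real.goldenRatio * e + (B : ℝ) * hφ2
    refine ⟨b, B, c, C, ?_, ?_, fun i => ⟨(hcC i).2.1, (hcC i).2.2, ?_, ?_⟩⟩
    · rw [hβc]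
      exact hb.1
    · rw [hβc]
      exact hb.2
    · rw [(hstep i).1]
      ring
    · rw [(hstep i).2]
      ring

end DoublePentagon

end
theorem theorem3 (β : ℝ)
    (hβ : DoublePentagon.IsTilingVertex (β : OnePoint ℝ))
    (hβ_mem : β ∈ Set.Ioo (Real.goldenRatio / 2 - 1) (1 - Real.goldenRatio / 2)) :
    (∃ γ : ℤ → ℝ, DoublePentagon.IsFan β γ) ∧
    ∀ γ : ℤ → ℝ, DoublePentagon.IsFan β γ →
      (∃ (b B : ℕ) (c C : ℤ → ℕ),
        DoublePentagon.IsPeriodPair (DoublePentagon.sideWords β) b B ∧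
        (∀ i, DoublePentagon.IsPeriodPair (DoublePentagon.sideWords (γ i)) (c i) (C i)) ∧
        ∀ i, DoublePentagon.signed c (i + 1) - DoublePentagon.signed c i = (B : ℤ) ∧
          DoublePentagon.signed C (i + 1) - DoublePentagon.signed C i = (b : ℤ) + (B : ℤ)) ∧
      (∃ (b B : ℕ) (c C : ℤ → ℕ),
        DoublePentagon.IsPeriodPair (DoublePentagon.intervalWords β) b B ∧
        (∀ i, DoublePentagon.IsPeriodPair (DoublePentagon.intervalWords (γ i)) (c i) (C i)) ∧
        ∀ i, DoublePentagon.signed c (i + 1) - DoublePentagon.signed c i = (B : ℤ) ∧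
          DoublePentagon.signed C (i + 1) - DoublePentagon.signed C i = (b : ℤ) + (B : ℤ)) := by
  have hmem : β ∈ Set.Ioo (-DoublePentagon.corner) DoublePentagon.corner := by
    simpa only [DoublePentagon.corner, neg_sub] using hβ_mem
  obtain ⟨γ₀, hγ₀, hA⟩ := DoublePentagon.exists_fan hβ hmem
  refine ⟨⟨γ₀, hγ₀⟩, fun γ hγ => ?_⟩
  -- Any list agrees with the constructed one up to reversal, which preserves the law.
  have hA' : DoublePentagon.ArithmeticPeriods β γ := by
    rcases hγ₀.eq_or_eq_reverse hγ with rfl | rfl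
    · exact hA
    · exact hA.reverse
  obtain ⟨b, B, c, C, h1, h2, h3⟩ := hA'
  refine ⟨⟨2 * b, 2 * B, fun i => 2 * c i, fun i => 2 * C i, h2, fun i => (h3 i).2.1,
    fun i => ?_⟩, b, B, c, C, h1, fun i => (h3 i).1, fun i => (h3 i).2.2⟩
  obtain ⟨-, -, e1, e2⟩ := h3 i
  simp only [DoublePentagon.signed_two_mul]
  push_cast
  omega
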